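/- Let $d\ge 1$, $\omega=e^{2\pi i/d}$, and let $X=\sum_{k\in\mathbb Z_d}|k+1\rangle\langle k|$ and $Z=\sum_{k\in\mathbb Z_d}\omega^k|k\rangle\langle k|$ be the shift and clock matrices on $\mathbb C^d$. A generalized Pauli matrix (GPM) is a matrix $X^sZ^t$ with $s,t\in\{0,\dots,d-1\}$, and a GPM-triple in the $d\otimes d$ system is a set of three distinct GPMs. Two GPM-triples $\mathcal M,\mathcal N$ are U-equivalent (equivalently, the corresponding triples of generalized Bell states are LU-equivalent) if there are unitary matrices $U_L,U_R$ and a bijection $\pi:\mathcal M\to\mathcal N$ such that every $M\in\mathcal M$ equals $U_L\,\pi(M)\,U_R$ up to a phase (a complex factor of modulus $1$, which may depend on $M$). For $x\in\mathbb Z_n$ put $$[x]_n=\{x,\,x^{-1},\,1-x,\,(1-x)^{-1},\,1-x^{-1},\,x(x-1)^{-1}\},\qquad [[x]]_n=\{x,\,1-x^{-1},\,(1-x)^{-1}\},$$ where an element is omitted if the inverse in it does not exist in $\mathbb Z_n$; minimal elements are taken with $\mathbb Z_n=\{0,\dots,n-1\}$. Let $p$ be a prime, $\alpha\ge 1$ and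 $d=p^\alpha$; all parameters below are non-negative integers. If $p>2$, every GPM-triple is U-equivalent to exactly one triple of the following list; all members of the list are GPM-triples, and members from different families, or from the same family with different parameters $(s,t)$, $(k,s,t)$, $(s,\hat m)$, $(k,s,t,\hat m)$, $(s,t,\hat m)$ respectively, are U-inequivalent. 1. $\{I,Z^{p^{s}},X^{p^{t}}\}$ with $1\le s\le t<\alpha$ and $s+t\ge\alpha$. 2. $\{I,Z^{p^{s}},X^{kp^{t}}\}$ with $0\le s\le t<\alpha$, $s+t<\alpha$, $1\le k\le \frac12p^{\alpha-s-t}$ and $\gcd(k,p)=1$. 3. $\{I,Z^{p^{s}},Z^{p^{s}\hat m}\}$ with $0\le s<\alpha$ and $\hat m$ the minimal element of $[m]_{p^{\alpha-s}}$ for some $2\le m<p^{\alpha-s}$. 4. $\{I,Z^{p^{s}},X^{kp^{t}}Z^{p^{s}\hat m}\}$ with $0\le s<t<\alpha$, $s+t<\alpha$, $1\le k\le\frac12p^{\alpha-s-t}$, $\gcd(k,p)=1$, and $\hat m$ the minimal element of $[[m]]_{p^{t-s}}$ for some $2\le m<p^{t-s}$. 5. $\{I,Z^{p^{s}},X^{p^{t}}Z^{p^{s}\hat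 m}\}$ with $0\le s<t<\alpha$, $s+t\ge\alpha$, and $\hat m$ the minimal element of $[m]_{p^{t-s}}$ for some $2\le m<p^{t-s}$. If $p=2$, the same holds with family 4 replaced by the following two families. 4.1. $\{I,Z^{2^{s}},X^{k2^{t}}Z^{2^{s}\hat m}\}$ with $0\le s<t<\alpha$, $s+t+1<\alpha$, $1\le k<2^{\alpha-s-t-1}$, $k$ odd, and $\hat m$ the minimal element of $[[m]]_{2^{t-s}}$ for some $2\le m<2^{t-s}$. 4.2. $\{I,Z^{2^{s}},X^{k2^{t}}Z^{2^{s}\hat m}\}$ with $0\le s<t<\alpha$, $s+t+1=\alpha$, $1\le k\le 2^{\alpha-s-t-1}$ (that is, $k=1$), and $\hat m$ the minimal element of $[m]_{2^{t-s}}$ for some $2\le m<2^{t-s}$. Moreover, the number of U-equivalence classes of GPM-triples in the $p^\alpha\otimes p^\alpha$ system is $$\frac{\alpha+3}{6}\,p^{\alpha}+O(\alpha p^{\alpha-1}),$$ with an absolute implied constant, uniformly over all primes $p$ and all integers $\alpha\ge1$. -/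

import Mathlib

open scoped Matrix

noncomputable section

namespace GPM

/-- The shift operator `X = ∑ₖ |k+1⟩⟨k|` on `ℂ^d`, with basis indexed by `ℤ/d`. -/
def shift (d : ℕ) : Matrix (ZMod d) (ZMod d) ℂ :=
  Matrix.of fun i j => if i = j + 1 then 1 else 0

/-- The root of unity `ω = exp(2πi/d)`. -/
def omega (d : ℕ) : ℂ := Complex.exp (2 * Real.pi * Complex.I / d)

/-- The clock operator `Z = ∑ₖ ω^k |k⟩⟨k|`. -/
def clock (d : ℕ) : Matrix (ZMod d) (ZMod d) ℂ :=
  Matrix.diagonal fun k => omega d ^ k.val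

/-- The generalized Pauli matrix `U_{s,t} = X^s Z^t`. -/
def pauli (d : ℕ) [NeZero d] (s t : ℕ) : Matrix (ZMod d) (ZMod d) ℂ :=
  shift d ^ s * clock d ^ t

/-- A GPM-triple: a set of exactly three generalized Pauli matrices. -/
def IsTriple (d : ℕ) [NeZero d] (T : Set (Matrix (ZMod d) (ZMod d) ℂ)) : Prop :=
  T.ncard = 3 ∧ ∀ A ∈ T, ∃ s t : ℕ, s < d ∧ t < d ∧ A = pauli d s t

/-- U-equivalence of two sets of matrices: one pair of unitaries `L`, `R` and a bijection `π`
with `A ≈ L (π A) R` for every `A`, where `≈` is equality up to a phase, which may depend on `A`. -/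
def UEquiv {d : ℕ} [NeZero d] (M N : Set (Matrix (ZMod d) (ZMod d) ℂ)) : Prop :=
  ∃ L ∈ Matrix.unitaryGroup (ZMod d) ℂ, ∃ R ∈ Matrix.unitaryGroup (ZMod d) ℂ,
    ∃ π : M ≃ N, ∀ A : M, ∃ c : ℂ, ‖c‖ = 1 ∧
      (A : Matrix (ZMod d) (ZMod d) ℂ) = c • (L * (π A : Matrix (ZMod d) (ZMod d) ℂ) * R)

theorem UEquiv.refl {d : ℕ} [NeZero d] (M : Set (Matrix (ZMod d) (ZMod d) ℂ)) : UEquiv M M :=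
  ⟨1, one_mem _, 1, one_mem _, Equiv.refl _, fun A => ⟨1, by simp, by simp⟩⟩

theorem UEquiv.symm {d : ℕ} [NeZero d] {M N : Set (Matrix (ZMod d) (ZMod d) ℂ)}
    (h : UEquiv M N) : UEquiv N M := by
  obtain ⟨L, hL, R, hR, π, hπ⟩ := h
  refine ⟨star L, Unitary.star_mem hL, star R, Unitary.star_mem hR, π.symm, fun B => ?_⟩
  obtain ⟨c, hc, hA⟩ := hπ (π.symm B)
  have hc0 : c ≠ 0 := by
    rintro rfl
    simp at hc
  refine ⟨c⁻¹, by simp [hc], ?_⟩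
  have h1 : star L * L = 1 := (Unitary.mem_iff.mp hL).1
  have h2 : R * star R = 1 := (Unitary.mem_iff.mp hR).2
  rw [hA, Equiv.apply_symm_apply, Matrix.mul_smul, Matrix.smul_mul, smul_smul,
    inv_mul_cancel₀ hc0, one_smul]
  calc (B : Matrix (ZMod d) (ZMod d) ℂ)
      = (star L * L) * B * (R * star R) := by rw [h1, h2, one_mul, mul_one]
    _ = star L * (L * B * R) * star R := by simp only [mul_assoc]

theorem UEquiv.trans {d : ℕ} [NeZero d] {M N P : Set (Matrix (ZMod d) (ZMod d) ℂ)}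
    (h : UEquiv M N) (h' : UEquiv N P) : UEquiv M P := by
  obtain ⟨L, hL, R, hR, π, hπ⟩ := h
  obtain ⟨L', hL', R', hR', π', hπ'⟩ := h'
  refine ⟨L * L', mul_mem hL hL', R' * R, mul_mem hR' hR, π.trans π', fun A => ?_⟩
  obtain ⟨c, hc, hA⟩ := hπ A
  obtain ⟨c', hc', hA'⟩ := hπ' (π A)
  refine ⟨c * c', by simp [hc, hc'], ?_⟩
  rw [hA, hA', Matrix.mul_smul, Matrix.smul_mul, smul_smul, Equiv.trans_apply]
  simp only [mul_assoc]

/-- U-equivalence as an equivalence relation on the GPM-triples of the `d ⊗ d` system. -/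
def tripleSetoid (d : ℕ) [NeZero d] :
    Setoid {T : Set (Matrix (ZMod d) (ZMod d) ℂ) // IsTriple d T} where
  r S T := UEquiv S.1 T.1
  iseqv := ⟨fun S => UEquiv.refl S.1, UEquiv.symm, UEquiv.trans⟩

/-- The number of U-inequivalent GPM-triples in the `d ⊗ d` system. -/
def numClasses (d : ℕ) [NeZero d] : ℕ := Nat.card (Quotient (tripleSetoid d))

/-- `[x] = {x, x⁻¹, 1-x, (1-x)⁻¹, 1-x⁻¹, x(x-1)⁻¹}` in `ℤ/d`; members whose inverse does not
exist are left out. -/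
def sixClass {d : ℕ} (x : ZMod d) : Set (ZMod d) :=
  {y | y = x ∨ (IsUnit x ∧ y = x⁻¹) ∨ y = 1 - x ∨ (IsUnit (1 - x) ∧ y = (1 - x)⁻¹) ∨
    (IsUnit x ∧ y = 1 - x⁻¹) ∨ (IsUnit (x - 1) ∧ y = x * (x - 1)⁻¹)}

/-- `[[x]] = {x, 1-x⁻¹, (1-x)⁻¹}` in `ℤ/d`; members whose inverse does not exist are left out. -/
def threeClass {d : ℕ} (x : ZMod d) : Set (ZMod d) :=
  {y | y = x ∨ (IsUnit x ∧ y = 1 - x⁻¹) ∨ (IsUnit (1 - x) ∧ y = (1 - x)⁻¹)}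

/-- `m` is the minimal element (in `{0, …, d-1}`) of `[x]` for some `2 ≤ x < d`. -/
def IsMinSix (d m : ℕ) : Prop :=
  ∃ x : ℕ, 2 ≤ x ∧ x < d ∧ IsLeast (ZMod.val '' sixClass (x : ZMod d)) m

/-- `m` is the minimal element (in `{0, …, d-1}`) of `[[x]]` for some `2 ≤ x < d`. -/
def IsMinThree (d m : ℕ) : Prop :=
  ∃ x : ℕ, 2 ≤ x ∧ x < d ∧ IsLeast (ZMod.val '' threeClass (x : ZMod d)) m

/-- The families of the classification, with their parameters. -/
inductive Label : Type
  | fam1 (s t : ℕ)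
  | fam2 (k s t : ℕ)
  | fam3 (s m : ℕ)
  | fam4 (k s t m : ℕ)
  | fam41 (k s t m : ℕ)
  | fam42 (k s t m : ℕ)
  | fam5 (s t m : ℕ)

/-- The admissible parameters of each family. For `p = 2`, family 4 is replaced by 4.1 and 4.2.
The bound `k ≤ p^e / 2` is written `2 * k ≤ p^e`. -/
def Label.Valid (p α : ℕ) : Label → Prop
  | .fam1 s t => 1 ≤ s ∧ s ≤ t ∧ t < α ∧ α ≤ s + t
  | .fam2 k s t => s ≤ t ∧ t < α ∧ s + t < α ∧ 1 ≤ k ∧ 2 * k ≤ p ^ (α - s - t) ∧ k.Coprime p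
  | .fam3 s m => s < α ∧ IsMinSix (p ^ (α - s)) m
  | .fam4 k s t m => p ≠ 2 ∧ s < t ∧ t < α ∧ s + t < α ∧
      1 ≤ k ∧ 2 * k ≤ p ^ (α - s - t) ∧ k.Coprime p ∧ IsMinThree (p ^ (t - s)) m
  | .fam41 k s t m => p = 2 ∧ s < t ∧ t < α ∧ s + t + 1 < α ∧
      1 ≤ k ∧ k < 2 ^ (α - s - t - 1) ∧ k.Coprime p ∧ IsMinThree (2 ^ (t - s)) m
  | .fam42 k s t m => p = 2 ∧ s < t ∧ t < α ∧ s + t + 1 = α ∧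
      1 ≤ k ∧ k ≤ 2 ^ (α - s - t - 1) ∧ k.Coprime p ∧ IsMinSix (2 ^ (t - s)) m
  | .fam5 s t m => s < t ∧ t < α ∧ α ≤ s + t ∧ IsMinSix (p ^ (t - s)) m

/-- The representing triple of a label in dimension `d` (used with `d = p ^ α`). -/
def Label.rep (p d : ℕ) [NeZero d] : Label → Set (Matrix (ZMod d) (ZMod d) ℂ)
  | .fam1 s t => {1, clock d ^ p ^ s, shift d ^ p ^ t}
  | .fam2 k s t => {1, clock d ^ p ^ s, shift d ^ (k * p ^ t)}
  | .fam3 s m => {1, clock d ^ p ^ s, clock d ^ (p ^ s * m)}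
  | .fam4 k s t m => {1, clock d ^ p ^ s, shift d ^ (k * p ^ t) * clock d ^ (p ^ s * m)}
  | .fam41 k s t m => {1, clock d ^ 2 ^ s, shift d ^ (k * 2 ^ t) * clock d ^ (2 ^ s * m)}
  | .fam42 k s t m => {1, clock d ^ 2 ^ s, shift d ^ (k * 2 ^ t) * clock d ^ (2 ^ s * m)}
  | .fam5 s t m => {1, clock d ^ p ^ s, shift d ^ p ^ t * clock d ^ (p ^ s * m)}

end GPM

end

noncomputable section

namespace GPM

/-! Up to phases a GPM is a Weyl operator W(v) with v in (ℤ/d)², so a GPM-triple is a triple of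
distinct points in this plane and U-equivalence becomes a relation between indexed triples taken up
to permutation (`uEquiv_range_iff`).

Enough unitaries exist: translations, shears, scalings and the Fourier matrix realise the affine
maps needed to move three points. Completing a primitive difference of minimal p-adic valuation to
an SL₂ matrix brings every triple to `normalForm`: 0, (0, p^s), (k p^t, p^s m), with p ∤ k and s ≤ t
≤ α (`exists_famEquiv_normalForm`). A permutation matrix acting separately on the cosets of p^t
allows k to change modulo p^(α-s-t) (`normalForm_congr_left`), and a shear changes m modulo p^(t-s)
(`normalForm_congr_right`). Reordering the points acts on m by the six fractional linear maps
permuting 0, 1, ∞, and on k by the sign of the permutation (`famEquiv_normalForm_of_ratioRel`).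

Nothing else is possible. Taking W(a i) W(a j)* eliminates the right unitary, so the differences of
the points are conjugated by one unitary. Hence zero-sum linear relations among the points are
preserved (`OrdEquiv.sum_smul_eq_zero`), and so are the symplectic forms of differences
(`OrdEquiv.symp_sub_eq`). The relations recover s, t and the orbit of m; the symplectic form p^(s+t)
k recovers k up to the same sign (`FamEquiv.normalForm_invariants`).

The list chooses one normal form per class: k is reduced to the range up to p^(α-s-t)/2, and m is
minimal under the permutations compatible with k. These are all of S₃ if k ≡ -k, and A₃ otherwise.
The degenerate orbit of m = 0 gives families 1 and 2, collinear triples with t = α give family 3,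
and the remaining cases give families 4 and 5. The exceptional modulus 2 causes the split for p = 2.

For the count, all but O(p^(j-1)) residues modulo p^j lie in free orbits. The leading contributions
are p^α/2 from family 2 with s = t = 0, p^α/6 from family 3 with s = 0, and p^α/6 from family 4 for
each pair s = 0 < t < α. Their sum is (α+3)p^α/6, and every other label goes into the error. -/

/-- Equality of matrices up to a phase. -/
def PhaseEq {n : Type*} (A B : Matrix n n ℂ) : Prop := ∃ c : ℂ, ‖c‖ = 1 ∧ A = c • B

section PhaseEq

variable {n : Type*} {A B C D : Matrix n n ℂ}

theorem PhaseEq.refl (A : Matrix n n ℂ) : PhaseEq A A := ⟨1, by simp, by simp⟩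

theorem PhaseEq.symm (h : PhaseEq A B) : PhaseEq B A := by
  obtain ⟨c, hc, rfl⟩ := h
  have hc0 : c ≠ 0 := by rintro rfl; simp at hc
  exact ⟨c⁻¹, by simp [hc], by rw [smul_smul, inv_mul_cancel₀ hc0, one_smul]⟩

theorem PhaseEq.trans (h : PhaseEq A B) (h' : PhaseEq B C) : PhaseEq A C := by
  obtain ⟨c, hc, rfl⟩ := h
  obtain ⟨c', hc', rfl⟩ := h'
  exact ⟨c * c', by simp [hc, hc'], by rw [smul_smul]⟩

theorem PhaseEq.mul [Fintype n] (h : PhaseEq A B) (h' : PhaseEq C D) : PhaseEq (A * C) (B * D) := by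
  obtain ⟨c, hc, rfl⟩ := h
  obtain ⟨c', hc', rfl⟩ := h'
  exact ⟨c * c', by simp [hc, hc'], by rw [Matrix.smul_mul, Matrix.mul_smul, smul_smul]⟩

theorem PhaseEq.star (h : PhaseEq A B) : PhaseEq (star A) (star B) := by
  obtain ⟨c, hc, rfl⟩ := h
  exact ⟨Star.star c, by simp [hc], by rw [star_smul]⟩

end PhaseEq

/-! ### Weyl operators and their commutation relations -/

variable {d : ℕ} [NeZero d]

/-- The standard additive character of `ℤ/d`. -/
abbrev chi (d : ℕ) [NeZero d] : AddChar (ZMod d) ℂ := ZMod.stdAddChar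

theorem norm_chi (x : ZMod d) : ‖chi d x‖ = 1 := by
  rw [ZMod.stdAddChar_apply]; exact Circle.norm_coe _

theorem star_chi (x : ZMod d) : star (chi d x) = chi d (-x) := by
  rw [ZMod.stdAddChar_apply, ZMod.stdAddChar_apply, AddChar.map_neg_eq_inv, Circle.coe_inv_eq_conj]
  rfl

theorem omega_pow (n : ℕ) : omega d ^ n = chi d n := by
  have := ZMod.stdAddChar_coe (N := d) (n : ℤ)
  rw [Int.cast_natCast] at this
  rw [this, omega, ← Complex.exp_nat_mul]
  congr 1
  push_cast
  ring

/-- The Weyl operator of a point of `(ℤ/d)²`. -/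
def weyl (v : ZMod d × ZMod d) : Matrix (ZMod d) (ZMod d) ℂ :=
  Matrix.of fun i j => if i = j + v.1 then chi d (v.2 * j) else 0

theorem weyl_apply (v : ZMod d × ZMod d) (i j : ZMod d) :
    weyl v i j = if i = j + v.1 then chi d (v.2 * j) else 0 := rfl

theorem weyl_mul (u v : ZMod d × ZMod d) :
    weyl u * weyl v = chi d (u.2 * v.1) • weyl (u + v) := by
  ext i j
  simp only [Matrix.mul_apply, weyl_apply, Matrix.smul_apply, smul_eq_mul, mul_ite, mul_zero]
  rw [Finset.sum_ite_eq' Finset.univ (j + v.1)]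
  simp only [Finset.mem_univ, if_true, Prod.fst_add, Prod.snd_add, ite_mul, zero_mul]
  refine if_congr (by rw [add_assoc, add_comm u.1]) ?_ rfl
  rw [← AddChar.map_add_eq_mul, ← AddChar.map_add_eq_mul]
  congr 1
  ring

theorem weyl_zero : weyl (0 : ZMod d × ZMod d) = 1 := by
  ext i j
  simp [weyl_apply, Matrix.one_apply]

theorem shift_pow (s : ℕ) : shift d ^ s = weyl ((s : ZMod d), 0) := by
  induction s with
  | zero => rw [pow_zero, Nat.cast_zero]; exact weyl_zero.symm
  | succ s ih =>
    have h1 : shift d = weyl (1, 0) := by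
      ext i j
      simp [weyl_apply, shift]
    rw [pow_succ, ih, h1, weyl_mul]
    simp

theorem clock_pow (t : ℕ) : clock d ^ t = weyl (0, (t : ZMod d)) := by
  ext i j
  rw [clock, Matrix.diagonal_pow, Matrix.diagonal_apply, weyl_apply]
  simp only [add_zero, Pi.pow_apply]
  refine ite_congr rfl (fun h => ?_) fun _ => rfl
  rw [← pow_mul, omega_pow, h]
  simp [mul_comm]

theorem shift_pow_mul_clock_pow (s t : ℕ) :
    shift d ^ s * clock d ^ t = weyl ((s : ZMod d), (t : ZMod d)) := by
  rw [shift_pow, clock_pow, weyl_mul]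
  simp

theorem star_weyl (v : ZMod d × ZMod d) : star (weyl v) = chi d (v.2 * v.1) • weyl (-v) := by
  ext i j
  rw [Matrix.star_apply, Matrix.smul_apply, weyl_apply, weyl_apply, apply_ite star, star_chi,
    star_zero, smul_eq_mul, mul_ite, mul_zero]
  have : (j = i + v.1) ↔ i = j + (-v).1 := by
    rw [Prod.fst_neg, ← sub_eq_add_neg, eq_sub_iff_add_eq, eq_comm]
  refine ite_congr (propext this) (fun h => ?_) fun _ => rfl
  rw [← AddChar.map_add_eq_mul, h, Prod.fst_neg, Prod.snd_neg]
  congr 1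
  ring

theorem star_weyl_mul_weyl (v : ZMod d × ZMod d) : star (weyl v) * weyl v = 1 := by
  rw [star_weyl, Matrix.smul_mul, weyl_mul, smul_smul, ← AddChar.map_add_eq_mul]
  simp [weyl_zero]

theorem weyl_mem_unitaryGroup (v : ZMod d × ZMod d) :
    weyl v ∈ Matrix.unitaryGroup (ZMod d) ℂ :=
  Matrix.mem_unitaryGroup_iff'.2 (star_weyl_mul_weyl v)

theorem phaseEq_weyl_mul (u v : ZMod d × ZMod d) : PhaseEq (weyl u * weyl v) (weyl (u + v)) :=
  ⟨_, norm_chi _, weyl_mul u v⟩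

theorem phaseEq_star_weyl (v : ZMod d × ZMod d) : PhaseEq (star (weyl v)) (weyl (-v)) :=
  ⟨_, norm_chi _, star_weyl v⟩

/-- Column 0 of a Weyl operator has a single nonzero entry, equal to 1, whose row is the first
coordinate; this also forces the phase to be 1. Column 1 then compares the values of an injective
character at the second coordinates. -/
theorem eq_of_phaseEq_weyl {u v : ZMod d × ZMod d} (h : PhaseEq (weyl u) (weyl v)) : u = v := by
  obtain ⟨c, hc, h⟩ := h
  have h0 := congrFun (congrFun h u.1) 0
  simp only [weyl_apply, Matrix.smul_apply, zero_add, mul_zero, AddChar.map_zero_eq_one,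
    if_true, smul_eq_mul] at h0
  have h1 : u.1 = v.1 := by
    by_contra hne
    simp [hne] at h0
  rw [if_pos h1, mul_one] at h0
  have h2 := congrFun (congrFun h (1 + u.1)) 1
  simp only [weyl_apply, Matrix.smul_apply, mul_one, smul_eq_mul, ← h0, one_mul, h1,
    if_true] at h2
  exact Prod.ext h1 (ZMod.injective_stdAddChar h2)

theorem weyl_injective : Function.Injective (weyl : ZMod d × ZMod d → _) :=
  fun _ _ h => eq_of_phaseEq_weyl (h ▸ PhaseEq.refl _)

/-- The symplectic form on `(ℤ/d)²`. -/
def symp (u v : ZMod d × ZMod d) : ZMod d := u.2 * v.1 - u.1 * v.2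

theorem weyl_mul_comm (u v : ZMod d × ZMod d) :
    weyl u * weyl v = chi d (symp u v) • (weyl v * weyl u) := by
  rw [weyl_mul, weyl_mul, smul_smul, ← AddChar.map_add_eq_mul, add_comm v u]
  congr 2
  rw [symp]
  ring

/-! ### Unitary moves on families of points -/

/-- Simultaneous unitary equivalence, up to phases, of two families of Weyl operators. -/
def OrdEquiv {ι : Type*} (a b : ι → ZMod d × ZMod d) : Prop :=
  ∃ L ∈ Matrix.unitaryGroup (ZMod d) ℂ, ∃ R ∈ Matrix.unitaryGroup (ZMod d) ℂ,
    ∀ i, PhaseEq (weyl (a i)) (L * weyl (b i) * R)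

section OrdEquiv

variable {ι : Type*} {a b c : ι → ZMod d × ZMod d}

theorem OrdEquiv.refl (a : ι → ZMod d × ZMod d) : OrdEquiv a a :=
  ⟨1, one_mem _, 1, one_mem _, fun i => by simpa using PhaseEq.refl _⟩

theorem OrdEquiv.symm (h : OrdEquiv a b) : OrdEquiv b a := by
  obtain ⟨L, hL, R, hR, h⟩ := h
  refine ⟨star L, Unitary.star_mem hL, star R, Unitary.star_mem hR, fun i => ?_⟩
  have h1 : star L * L = 1 := (Unitary.mem_iff.mp hL).1
  have h2 : R * star R = 1 := (Unitary.mem_iff.mp hR).2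
  have := ((PhaseEq.refl (star L)).mul (h i)).mul (PhaseEq.refl (star R))
  have e : star L * (L * weyl (b i) * R) * star R = weyl (b i) := by
    calc _ = (star L * L) * weyl (b i) * (R * star R) := by simp only [mul_assoc]
      _ = _ := by rw [h1, h2, one_mul, mul_one]
  rw [e] at this
  exact this.symm

theorem OrdEquiv.trans (h : OrdEquiv a b) (h' : OrdEquiv b c) : OrdEquiv a c := by
  obtain ⟨L, hL, R, hR, h⟩ := h
  obtain ⟨L', hL', R', hR', h'⟩ := h'
  refine ⟨L * L', mul_mem hL hL', R' * R, mul_mem hR' hR, fun i => ?_⟩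
  have := (h i).trans (((PhaseEq.refl L).mul (h' i)).mul (PhaseEq.refl R))
  simpa only [mul_assoc] using this

theorem OrdEquiv.comp {κ : Type*} (h : OrdEquiv a b) (f : κ → ι) :
    OrdEquiv (a ∘ f) (b ∘ f) := by
  obtain ⟨L, hL, R, hR, h⟩ := h
  exact ⟨L, hL, R, hR, fun i => h (f i)⟩

theorem OrdEquiv.of_conj {U : Matrix (ZMod d) (ZMod d) ℂ}
    (hU : U ∈ Matrix.unitaryGroup (ZMod d) ℂ)
    (h : ∀ i, PhaseEq (U * weyl (a i)) (weyl (b i) * U)) : OrdEquiv a b := by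
  refine ⟨star U, Unitary.star_mem hU, U, hU, fun i => ?_⟩
  have := (PhaseEq.refl (star U)).mul (h i)
  rwa [← mul_assoc, (Unitary.mem_iff.mp hU).1, one_mul, ← mul_assoc] at this

theorem ordEquiv_translate (a : ι → ZMod d × ZMod d) (v : ZMod d × ZMod d) :
    OrdEquiv a (fun i => a i - v) :=
  ⟨weyl v, weyl_mem_unitaryGroup v, 1, one_mem _, fun i => by
    simpa using (phaseEq_weyl_mul v (a i - v)).symm⟩

/-- The monomial matrix of a permutation and a diagonal of phases. -/
def monomialMatrix (σ : Equiv.Perm (ZMod d)) (D : ZMod d → ℂ) : Matrix (ZMod d) (ZMod d) ℂ :=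
  Matrix.of fun i j => if i = σ j then D j else 0

theorem monomialMatrix_mem_unitaryGroup (σ : Equiv.Perm (ZMod d)) {D : ZMod d → ℂ}
    (hD : ∀ j, ‖D j‖ = 1) : monomialMatrix σ D ∈ Matrix.unitaryGroup (ZMod d) ℂ := by
  rw [Matrix.mem_unitaryGroup_iff']
  ext i j
  simp only [Matrix.mul_apply, Matrix.star_apply, monomialMatrix, Matrix.of_apply, mul_ite,
    mul_zero, Finset.sum_ite_eq', Finset.mem_univ, if_true, Matrix.one_apply,
    EmbeddingLike.apply_eq_iff_eq]
  by_cases h : i = j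
  · subst h
    have : star (D i) * D i = 1 := by
      have := Complex.conj_mul' (D i)
      rw [hD] at this
      simpa using this
    simpa using this
  · simp [h, Ne.symm h]

/-- Column by column comparison of U W(a i) with W(b i) U: `h1` matches the positions of the nonzero
entries, and `h2` their values. The scalar may depend on i but not on the column. -/
theorem ordEquiv_of_monomial (σ : Equiv.Perm (ZMod d)) {D : ZMod d → ℂ} (hD : ∀ j, ‖D j‖ = 1)
    (h1 : ∀ i j, σ (j + (a i).1) = σ j + (b i).1)
    (h2 : ∀ i, ∃ c : ℂ, ‖c‖ = 1 ∧
      ∀ j, D (j + (a i).1) * chi d ((a i).2 * j) = c * (chi d ((b i).2 * σ j) * D j)) :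
    OrdEquiv a b := by
  refine .of_conj (monomialMatrix_mem_unitaryGroup σ hD) fun i => ?_
  obtain ⟨c, hc, h2⟩ := h2 i
  refine ⟨c, hc, ?_⟩
  ext k j
  simp only [Matrix.mul_apply, Matrix.smul_apply, monomialMatrix, weyl_apply, Matrix.of_apply,
    mul_ite, mul_zero, Finset.sum_ite_eq', Finset.mem_univ, if_true, ite_mul, zero_mul,
    smul_eq_mul, h1]
  rw [h2]

/-- The quadratic phase `exp(πi n(n+d)/d)`. -/
def quadPhase (d : ℕ) (n : ℤ) : ℂ := Complex.exp (Real.pi * Complex.I * (n * (n + d)) / d)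

theorem norm_quadPhase (d : ℕ) (n : ℤ) : ‖quadPhase d n‖ = 1 := by
  have : (Real.pi * Complex.I * (n * (n + d)) / d : ℂ)
      = ((Real.pi * (n * (n + d)) / d : ℝ) : ℂ) * Complex.I := by
    push_cast; ring
  rw [quadPhase, this, Complex.norm_exp_ofReal_mul_I]

theorem quadPhase_add (m n : ℤ) :
    quadPhase d (m + n) = quadPhase d m * quadPhase d n * chi d ((m : ZMod d) * n) := by
  have := ZMod.stdAddChar_coe (N := d) (m * n)
  rw [Int.cast_mul] at this
  rw [this, quadPhase, quadPhase, quadPhase, ← Complex.exp_add, ← Complex.exp_add]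
  congr 1
  push_cast
  ring

/-- The summand d in n(n+d) is what gives period d for both parities: the exponent becomes πi d
y(y+1), and y(y+1) is even. -/
theorem quadPhase_mul_self (y : ℤ) : quadPhase d (d * y) = 1 := by
  have hd : (d : ℂ) ≠ 0 := Nat.cast_ne_zero.2 (NeZero.ne d)
  obtain ⟨r, hr⟩ : Even (y * (y + 1)) := Int.even_mul_succ_self y
  rw [quadPhase, Complex.exp_eq_one_iff]
  refine ⟨d * r, ?_⟩
  have hr' : (y * (y + 1) : ℂ) = r + r := by exact_mod_cast hr
  have : (Real.pi * Complex.I * (((d * y : ℤ) : ℂ) * ((d * y : ℤ) + d)) / d : ℂ)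
      = Real.pi * Complex.I * d * (y * (y + 1)) := by
    push_cast; field_simp
  rw [this, hr']
  push_cast
  ring

theorem quadPhase_congr {m n : ℤ} (h : (m : ZMod d) = n) : quadPhase d m = quadPhase d n := by
  rw [ZMod.intCast_eq_intCast_iff_dvd_sub] at h
  obtain ⟨y, hy⟩ := h
  have : n = m + d * y := by omega
  rw [this, quadPhase_add, quadPhase_mul_self]
  simp

/-- Conjugation by the diagonal quadratic phase: its cross term χ(j · a₁) is exactly the clock
factor added to the operator. -/
theorem ordEquiv_shear_one (a : ι → ZMod d × ZMod d) :
    OrdEquiv a (fun i => ((a i).1, (a i).2 + (a i).1)) := by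
  refine ordEquiv_of_monomial 1 (D := fun j => quadPhase d j.val) (fun j => norm_quadPhase d _)
    (fun i j => rfl) fun i => ⟨quadPhase d (a i).1.val, norm_quadPhase d _, fun j => ?_⟩
  have : quadPhase d (j + (a i).1).val
      = quadPhase d j.val * quadPhase d (a i).1.val * chi d (j * (a i).1) := by
    rw [quadPhase_congr (n := (j.val : ℤ) + (a i).1.val) (by simp), quadPhase_add]
    simp
  rw [this, Equiv.Perm.one_apply, add_mul, AddChar.map_add_eq_mul, mul_comm j]
  ring

theorem ordEquiv_shear (a : ι → ZMod d × ZMod d) (c : ZMod d) :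
    OrdEquiv a (fun i => ((a i).1, (a i).2 + c * (a i).1)) := by
  have key : ∀ n : ℕ, OrdEquiv a (fun i => ((a i).1, (a i).2 + n * (a i).1)) := by
    intro n
    induction n with
    | zero => simpa using OrdEquiv.refl a
    | succ n ih =>
      refine ih.trans ?_
      have := ordEquiv_shear_one fun i => ((a i).1, (a i).2 + n * (a i).1)
      simpa [add_mul, add_assoc] using this
  simpa using key c.val

theorem ordEquiv_scale (a : ι → ZMod d × ZMod d) (u : (ZMod d)ˣ) :
    OrdEquiv a (fun i => (u * (a i).1, (↑u⁻¹ : ZMod d) * (a i).2)) := by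
  refine ordEquiv_of_monomial (Units.mulLeft u) (D := fun _ => 1) (by simp)
    (fun i j => by simp [mul_add]) fun i => ⟨1, by simp, fun j => ?_⟩
  have : (↑u⁻¹ : ZMod d) * (a i).2 * (u * j) = (a i).2 * j := by
    rw [show (↑u⁻¹ : ZMod d) * (a i).2 * (u * j) = (↑u⁻¹ * u : ZMod d) * ((a i).2 * j) by ring,
      Units.inv_mul, one_mul]
  simp [Units.mulLeft_apply, this]

/-- The discrete Fourier matrix. -/
def fourier (d : ℕ) [NeZero d] : Matrix (ZMod d) (ZMod d) ℂ :=
  Matrix.of fun i j => ((Real.sqrt d : ℝ) : ℂ)⁻¹ * chi d (i * j)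

theorem fourier_mem_unitaryGroup : fourier d ∈ Matrix.unitaryGroup (ZMod d) ℂ := by
  rw [Matrix.mem_unitaryGroup_iff]
  ext i j
  have hd : ((Real.sqrt d : ℝ) : ℂ) * ((Real.sqrt d : ℝ) : ℂ) = d := by
    rw [← Complex.ofReal_mul, Real.mul_self_sqrt (Nat.cast_nonneg d)]
    simp
  have hd0 : (d : ℂ) ≠ 0 := Nat.cast_ne_zero.2 (NeZero.ne d)
  have hterm : ∀ k, fourier d i k * star (fourier d) k j = (d : ℂ)⁻¹ * chi d (k * (i - j)) := by
    intro k
    rw [Matrix.star_apply, fourier, Matrix.of_apply, Matrix.of_apply, star_mul', star_chi,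
      ← hd, mul_inv, show k * (i - j) = i * k + -(j * k) by ring, AddChar.map_add_eq_mul]
    have : star (((Real.sqrt d : ℝ) : ℂ)⁻¹) = (((Real.sqrt d : ℝ) : ℂ)⁻¹) := by
      rw [star_inv₀]
      exact congrArg _ (Complex.conj_ofReal _)
    rw [this]
    ring
  rw [Matrix.mul_apply, Finset.sum_congr rfl fun k _ => hterm k, ← Finset.mul_sum,
    AddChar.sum_mulShift _ (ZMod.isPrimitive_stdAddChar d), Matrix.one_apply, ZMod.card]
  by_cases h : i = j
  · simp [h, hd0]
  · simp [h, sub_eq_zero]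

theorem ordEquiv_fourier (a : ι → ZMod d × ZMod d) :
    OrdEquiv a (fun i => (-(a i).2, (a i).1)) := by
  refine .of_conj fourier_mem_unitaryGroup fun i => ?_
  refine ⟨chi d (-((a i).1 * (a i).2)), norm_chi _, ?_⟩
  ext k j
  simp only [Matrix.mul_apply, Matrix.smul_apply, weyl_apply, fourier, Matrix.of_apply,
    mul_ite, mul_zero, ite_mul, zero_mul, smul_eq_mul]
  have : ∀ x : ZMod d, (k = x + -(a i).2) ↔ x = k + (a i).2 := fun x => by
    rw [← sub_eq_add_neg, eq_sub_iff_add_eq, eq_comm]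
  simp only [this, Finset.sum_ite_eq', Finset.mem_univ, if_true]
  rw [mul_assoc, ← AddChar.map_add_eq_mul, mul_left_comm (chi d ((a i).1 * _)),
    mul_left_comm (chi d _), ← AddChar.map_add_eq_mul, ← AddChar.map_add_eq_mul]
  congr 2
  ring

end OrdEquiv

/-! ### Invariants of unitary equivalence, and passage from sets to families -/

section Invariants

variable {d : ℕ} [NeZero d] {ι : Type*} {a b c : ι → ZMod d × ZMod d}

/-- The pairs of points whose Weyl operators are conjugate, up to a phase, under `L`. -/
def conjPairs (L : Matrix.unitaryGroup (ZMod d) ℂ) :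
    AddSubmonoid ((ZMod d × ZMod d) × (ZMod d × ZMod d)) where
  carrier := {q | PhaseEq (weyl q.1) (L.1 * weyl q.2 * star L.1)}
  zero_mem' := by
    have : L.1 * star L.1 = 1 := (Unitary.mem_iff.mp L.2).2
    simpa [weyl_zero, this] using PhaseEq.refl _
  add_mem' := by
    intro q r hq hr
    have h1 : star L.1 * L.1 = 1 := (Unitary.mem_iff.mp L.2).1
    have e : L.1 * weyl q.2 * star L.1 * (L.1 * weyl r.2 * star L.1)
        = L.1 * (weyl q.2 * weyl r.2) * star L.1 := by
      calc _ = L.1 * weyl q.2 * (star L.1 * L.1) * weyl r.2 * star L.1 := by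
            simp only [mul_assoc]
        _ = _ := by rw [h1, mul_one]; simp only [mul_assoc]
    have h2 := (phaseEq_weyl_mul q.1 r.1).symm.trans (PhaseEq.mul hq hr)
    rw [e] at h2
    exact h2.trans (((PhaseEq.refl L.1).mul (phaseEq_weyl_mul q.2 r.2)).mul (PhaseEq.refl _))

theorem mem_conjPairs {L : Matrix.unitaryGroup (ZMod d) ℂ} {u v : ZMod d × ZMod d} :
    (u, v) ∈ conjPairs L ↔ PhaseEq (weyl u) (L.1 * weyl v * star L.1) := Iff.rfl

theorem eq_zero_of_mem_conjPairs {L : Matrix.unitaryGroup (ZMod d) ℂ} {v : ZMod d × ZMod d}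
    (h : (0, v) ∈ conjPairs L) : v = 0 := by
  rw [mem_conjPairs, weyl_zero] at h
  have h1 : star L.1 * L.1 = 1 := (Unitary.mem_iff.mp L.2).1
  have h2 := ((PhaseEq.refl (star L.1)).mul h).mul (PhaseEq.refl L.1)
  have e : star L.1 * (L.1 * weyl v * star L.1) * L.1 = weyl v := by
    calc _ = (star L.1 * L.1) * weyl v * (star L.1 * L.1) := by simp only [mul_assoc]
      _ = _ := by rw [h1, one_mul, mul_one]
  rw [e, mul_one, h1, ← weyl_zero] at h2
  exact (eq_of_phaseEq_weyl h2).symm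

/-- The commutator of two Weyl operators is the scalar χ(symp); conjugation and phases leave it
unchanged, and χ is injective. -/
theorem symp_eq_of_mem_conjPairs {L : Matrix.unitaryGroup (ZMod d) ℂ}
    {u v u' v' : ZMod d × ZMod d}
    (h : (u, u') ∈ conjPairs L) (h' : (v, v') ∈ conjPairs L) : symp u v = symp u' v' := by
  obtain ⟨c, hc, h⟩ := h
  obtain ⟨c', hc', h'⟩ := h'
  have hc0 : c ≠ 0 := by rintro rfl; simp at hc
  have hc0' : c' ≠ 0 := by rintro rfl; simp at hc'
  have h1 : star L.1 * L.1 = 1 := (Unitary.mem_iff.mp L.2).1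
  have e : ∀ q r : ZMod d × ZMod d, L.1 * weyl q * star L.1 * (L.1 * weyl r * star L.1)
        = L.1 * (weyl q * weyl r) * star L.1 := fun q r => by
    calc _ = L.1 * weyl q * (star L.1 * L.1) * weyl r * star L.1 := by simp only [mul_assoc]
      _ = _ := by rw [h1, mul_one]; simp only [mul_assoc]
  simp only at h h'
  have h2 := weyl_mul_comm u v
  have h3 : weyl u * weyl v = chi d (symp u' v') • (weyl v * weyl u) := by
    rw [h, h', Matrix.smul_mul, Matrix.mul_smul, Matrix.smul_mul, Matrix.mul_smul, e, e,
      weyl_mul_comm u' v', Matrix.mul_smul, Matrix.smul_mul, smul_comm c, smul_comm c,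
      smul_comm c']
  rw [h2] at h3
  have h4 : star (weyl v * weyl u) * (weyl v * weyl u) = 1 :=
    (Unitary.mem_iff.mp (mul_mem (weyl_mem_unitaryGroup v) (weyl_mem_unitaryGroup u))).1
  have h5 := congrArg (fun M => star (weyl v * weyl u) * M) h3
  simp only [Matrix.mul_smul, h4] at h5
  have h6 := congrFun (congrFun h5 0) 0
  simp only [Matrix.smul_apply, Matrix.one_apply_eq, smul_eq_mul, mul_one] at h6
  exact ZMod.injective_stdAddChar h6

/-- In W(a i) W(a j)* the right unitary cancels, leaving conjugation by L. -/
theorem OrdEquiv.exists_conjPairs (h : OrdEquiv a b) :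
    ∃ L : Matrix.unitaryGroup (ZMod d) ℂ, ∀ i j, (a i - a j, b i - b j) ∈ conjPairs L := by
  obtain ⟨L, hL, R, hR, h⟩ := h
  refine ⟨⟨L, hL⟩, fun i j => ?_⟩
  have h2 : R * star R = 1 := (Unitary.mem_iff.mp hR).2
  have diff : ∀ u v : ZMod d × ZMod d, PhaseEq (weyl u * star (weyl v)) (weyl (u - v)) :=
    fun u v => by
      rw [sub_eq_add_neg]
      exact ((PhaseEq.refl _).mul (phaseEq_star_weyl v)).trans (phaseEq_weyl_mul _ _)
  have h3 := (diff (a i) (a j)).symm.trans ((h i).mul (h j).star)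
  have e : L * weyl (b i) * R * star (L * weyl (b j) * R)
      = L * (weyl (b i) * star (weyl (b j))) * star L := by
    rw [star_mul, star_mul]
    calc _ = L * weyl (b i) * (R * star R) * star (weyl (b j)) * star L := by
          simp only [mul_assoc]
      _ = _ := by rw [h2, mul_one]; simp only [mul_assoc]
  rw [e] at h3
  exact mem_conjPairs.2 (h3.trans (((PhaseEq.refl L).mul (diff _ _)).mul (PhaseEq.refl _)))

/-- A combination with coefficient sum zero is a combination of differences, so it pairs with its
counterpart under L; only the zero vector is paired with zero. -/
theorem OrdEquiv.sum_smul_eq_zero [Fintype ι] (h : OrdEquiv a b) {c : ι → ZMod d}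
    (hc : ∑ i, c i = 0) (ha : ∑ i, c i • a i = 0) : ∑ i, c i • b i = 0 := by
  obtain ⟨L, hL⟩ := h.exists_conjPairs
  rcases isEmpty_or_nonempty ι with hι | ⟨⟨i₀⟩⟩
  · simp
  -- The paired vectors form only an additive monoid, so the coefficients are lifted to natural
  -- numbers.
  have key : ∀ f : ι → ZMod d × ZMod d, ∑ i, (c i).val • (f i - f i₀) = ∑ i, c i • f i := by
    intro f
    have h1 : ∀ i, (c i).val • (f i - f i₀) = c i • f i - c i • f i₀ := fun i => by
      rw [← smul_sub, ← Nat.cast_smul_eq_nsmul (ZMod d), ZMod.natCast_zmod_val]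
    simp only [h1, Finset.sum_sub_distrib, ← Finset.sum_smul, hc, zero_smul, sub_zero]
  have h2 : (∑ i, (c i).val • ((a i - a i₀, b i - b i₀) :
      (ZMod d × ZMod d) × (ZMod d × ZMod d))) ∈ conjPairs L :=
    sum_mem fun i _ => nsmul_mem (hL i i₀) _
  have h3 : (∑ i, (c i).val • ((a i - a i₀, b i - b i₀) :
      (ZMod d × ZMod d) × (ZMod d × ZMod d))) = (0, ∑ i, c i • b i) := by
    refine Prod.ext ?_ ?_
    · rw [Prod.fst_sum]
      exact (key a).trans ha
    · rw [Prod.snd_sum]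
      exact key b
  rw [h3] at h2
  exact eq_zero_of_mem_conjPairs h2

theorem OrdEquiv.symp_sub_eq (h : OrdEquiv a b) (i j k : ι) :
    symp (a i - a k) (a j - a k) = symp (b i - b k) (b j - b k) := by
  obtain ⟨L, hL⟩ := h.exists_conjPairs
  exact symp_eq_of_mem_conjPairs (hL i k) (hL j k)

/-- `OrdEquiv` up to a permutation of the index set. -/
def FamEquiv (a b : ι → ZMod d × ZMod d) : Prop := ∃ σ : Equiv.Perm ι, OrdEquiv a (b ∘ σ)

theorem OrdEquiv.famEquiv (h : OrdEquiv a b) : FamEquiv a b := ⟨1, h⟩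

theorem FamEquiv.symm (h : FamEquiv a b) : FamEquiv b a := by
  obtain ⟨σ, h⟩ := h
  refine ⟨σ⁻¹, ?_⟩
  have := h.symm.comp (σ⁻¹ : Equiv.Perm ι)
  rwa [Function.comp_assoc, ← Equiv.Perm.coe_mul, mul_inv_cancel, Equiv.Perm.coe_one,
    Function.comp_id] at this

theorem FamEquiv.trans (h : FamEquiv a b) (h' : FamEquiv b c) : FamEquiv a c := by
  obtain ⟨σ, h⟩ := h
  obtain ⟨τ, h'⟩ := h'
  exact ⟨τ * σ, h.trans (h'.comp σ)⟩

theorem famEquiv_comp (a : ι → ZMod d × ZMod d) (σ : Equiv.Perm ι) : FamEquiv (a ∘ σ) a :=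
  ⟨σ, .refl _⟩

theorem uEquiv_range_iff (ha : Function.Injective a) (hb : Function.Injective b) :
    UEquiv (Set.range (weyl ∘ a)) (Set.range (weyl ∘ b)) ↔ FamEquiv a b := by
  let ea : ι ≃ Set.range (weyl ∘ a) := Equiv.ofInjective _ (weyl_injective.comp ha)
  let eb : ι ≃ Set.range (weyl ∘ b) := Equiv.ofInjective _ (weyl_injective.comp hb)
  have hea : ∀ i, (ea i : Matrix (ZMod d) (ZMod d) ℂ) = weyl (a i) := fun _ => rfl
  have heb : ∀ i, (eb i : Matrix (ZMod d) (ZMod d) ℂ) = weyl (b i) := fun _ => rfl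
  constructor
  · rintro ⟨L, hL, R, hR, π, h⟩
    refine ⟨(ea.trans π).trans eb.symm, L, hL, R, hR, fun i => ?_⟩
    have : PhaseEq _ _ := h (ea i)
    rw [hea] at this
    rw [Function.comp_apply, ← heb]
    simpa using this
  · rintro ⟨σ, L, hL, R, hR, h⟩
    refine ⟨L, hL, R, hR, (ea.symm.trans σ).trans eb, fun A => ?_⟩
    obtain ⟨i, rfl⟩ := ea.surjective A
    change PhaseEq _ _
    rw [hea]
    simpa [heb] using h i

theorem FamEquiv.injective (h : FamEquiv a b) (ha : Function.Injective a) :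
    Function.Injective b := by
  obtain ⟨σ, h⟩ := h
  obtain ⟨L, hL⟩ := h.symm.exists_conjPairs
  have : Function.Injective (b ∘ σ) := fun i j hij => by
    have h1 := hL i j
    rw [hij, sub_self] at h1
    exact ha (sub_eq_zero.1 (eq_zero_of_mem_conjPairs h1))
  have h2 := this.comp (σ⁻¹).injective
  rwa [Function.comp_assoc, ← Equiv.Perm.coe_mul, mul_inv_cancel, Equiv.Perm.coe_one,
    Function.comp_id] at h2

theorem isTriple_iff {T : Set (Matrix (ZMod d) (ZMod d) ℂ)} : IsTriple d T ↔
    ∃ a : Fin 3 → ZMod d × ZMod d, Function.Injective a ∧ T = Set.range (weyl ∘ a) := by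
  constructor
  · rintro ⟨hT, h⟩
    have hfin : T.Finite := Set.finite_of_ncard_ne_zero (by omega)
    have hcard : Nat.card T = 3 := hT
    have : Finite T := hfin
    let e : Fin 3 ≃ T := (Finite.equivFinOfCardEq hcard).symm
    have h' : ∀ i, ∃ v : ZMod d × ZMod d, (e i : Matrix (ZMod d) (ZMod d) ℂ) = weyl v := by
      intro i
      obtain ⟨s, t, -, -, h⟩ := h _ (e i).2
      exact ⟨(s, t), by rw [h, pauli, shift_pow_mul_clock_pow]⟩
    choose a ha using h'
    refine ⟨a, fun i j hij => e.injective (Subtype.ext ?_), ?_⟩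
    · rw [ha, ha, hij]
    · ext A
      constructor
      · intro hA
        exact ⟨e.symm ⟨A, hA⟩, by rw [Function.comp_apply, ← ha, Equiv.apply_symm_apply]⟩
      · rintro ⟨i, rfl⟩
        rw [Function.comp_apply, ← ha]
        exact (e i).2
  · rintro ⟨a, ha, rfl⟩
    refine ⟨?_, ?_⟩
    · have := Nat.card_congr (Equiv.ofInjective _ (weyl_injective.comp ha))
      rw [Nat.card_eq_fintype_card, Fintype.card_fin] at this
      exact this.symm
    · rintro A ⟨i, rfl⟩
      refine ⟨(a i).1.val, (a i).2.val, ZMod.val_lt _, ZMod.val_lt _, ?_⟩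
      rw [pauli, shift_pow_mul_clock_pow]
      simp

/-! ### The special linear action -/

theorem ordEquiv_upperShear (a : ι → ZMod d × ZMod d) (c : ZMod d) :
    OrdEquiv a (fun i => ((a i).1 + c * (a i).2, (a i).2)) := by
  have h1 := (ordEquiv_fourier a).trans (ordEquiv_shear _ (-c))
  have h2 := (h1.trans (ordEquiv_fourier _)).trans (ordEquiv_scale _ (-1))
  simpa using h2

/-- With a unit in the corner, the matrix factors as lower shear, diagonal, upper shear. -/
theorem ordEquiv_linear_of_isUnit (a : ι → ZMod d × ZMod d) {A B C D : ZMod d}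
    (hA : IsUnit A) (hdet : A * D - B * C = 1) :
    OrdEquiv a (fun i => (A * (a i).1 + B * (a i).2, C * (a i).1 + D * (a i).2)) := by
  obtain ⟨u, rfl⟩ := hA
  have h := ((ordEquiv_upperShear a ((↑u⁻¹ : ZMod d) * B)).trans (ordEquiv_scale _ u)).trans
    (ordEquiv_shear _ ((↑u⁻¹ : ZMod d) * C))
  have hu : (u : ZMod d) * ↑u⁻¹ = 1 := Units.mul_inv u
  convert h using 3 with i
  · linear_combination (-B * (a i).2) * hu
  · linear_combination (-C * (a i).1 - (↑u⁻¹ : ZMod d) * (a i).2 * C * B - (a i).2 * D) * hu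
      + (↑u⁻¹ * (a i).2) * hdet

theorem ordEquiv_linear (a : ι → ZMod d × ZMod d) {A B C D : ZMod d}
    (hAC : IsUnit A ∨ IsUnit C) (hdet : A * D - B * C = 1) :
    OrdEquiv a (fun i => (A * (a i).1 + B * (a i).2, C * (a i).1 + D * (a i).2)) := by
  rcases hAC with hA | hC
  · exact ordEquiv_linear_of_isUnit a hA hdet
  -- A quarter turn by the Fourier matrix moves the unit C into the corner.
  · have h1 := ordEquiv_linear_of_isUnit a (A := -C) (B := -D) (C := A) (D := B) hC.neg
      (by linear_combination hdet)
    refine h1.trans (OrdEquiv.symm ?_)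
    have h2 := ordEquiv_fourier fun i => (A * (a i).1 + B * (a i).2, C * (a i).1 + D * (a i).2)
    simpa [neg_add, add_comm] using h2

end Invariants

/-! ### The action of S₃ by fractional linear maps, without denominators -/

section Ratios

variable {R : Type*} [CommRing R]

/-- The coefficients, of sum zero, of an affine dependency of three collinear points. -/
def ratios (x : R) : Fin 3 → R := ![x - 1, -x, 1]

/-- `y` is the image of `x` under the fractional linear action of the permutation `σ`. -/
def RatioRel (σ : Equiv.Perm (Fin 3)) (x y : R) : Prop :=
  ratios x (σ 1) + ratios x (σ 2) * y = 0

theorem perm_fin_three (σ : Equiv.Perm (Fin 3)) :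
    σ = 1 ∨ σ = Equiv.swap 0 1 ∨ σ = Equiv.swap 1 2 ∨ σ = Equiv.swap 0 2 ∨
      σ = Equiv.swap 0 1 * Equiv.swap 1 2 ∨ σ = Equiv.swap 1 2 * Equiv.swap 0 1 := by
  revert σ
  decide

theorem sum_ratios (x : R) (σ : Equiv.Perm (Fin 3)) :
    ratios x (σ 0) + ratios x (σ 1) + ratios x (σ 2) = 0 := by
  have := Equiv.sum_comp σ (ratios x)
  rw [Fin.sum_univ_three, Fin.sum_univ_three] at this
  rw [this]
  simp only [ratios, Matrix.cons_val]
  ring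

/-- Both triples of coefficients sum to zero and the last one for y is 1, so a single equation
forces proportionality. In this form composition and inversion need no case distinction on units. -/
theorem ratioRel_iff {σ : Equiv.Perm (Fin 3)} {x y : R} :
    RatioRel σ x y ↔ ∃ c, ∀ i, ratios x (σ i) = c * ratios y i := by
  constructor
  · intro h
    rw [RatioRel] at h
    refine ⟨ratios x (σ 2), fun i => ?_⟩
    have := sum_ratios x σ
    fin_cases i
    · simp only [ratios, Fin.zero_eta, Matrix.cons_val_zero] at *
      linear_combination this - h
    · simp only [ratios, Fin.mk_one, Matrix.cons_val_one, Matrix.cons_val_zero] at *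
      linear_combination h
    · simp [ratios]
  · rintro ⟨c, h⟩
    rw [RatioRel, h, h]
    simp [ratios]

theorem RatioRel.trans {σ τ : Equiv.Perm (Fin 3)} {x y z : R} (h : RatioRel σ x y)
    (h' : RatioRel τ y z) : RatioRel (σ * τ) x z := by
  rw [ratioRel_iff] at *
  obtain ⟨c, h⟩ := h
  obtain ⟨c', h'⟩ := h'
  exact ⟨c * c', fun i => by rw [Equiv.Perm.mul_apply, h, h', mul_assoc]⟩

theorem RatioRel.symm {σ : Equiv.Perm (Fin 3)} {x y : R} (h : RatioRel σ x y) :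
    RatioRel σ⁻¹ y x := by
  rw [ratioRel_iff] at *
  obtain ⟨c, h⟩ := h
  have h1 : c * ratios y (σ⁻¹ 2) = 1 := by
    rw [← h, ← Equiv.Perm.mul_apply, mul_inv_cancel]
    simp [ratios]
  refine ⟨ratios y (σ⁻¹ 2), fun i => ?_⟩
  have h2 := h (σ⁻¹ i)
  rw [← Equiv.Perm.mul_apply, mul_inv_cancel, Equiv.Perm.one_apply] at h2
  rw [h2]
  linear_combination (-ratios y (σ⁻¹ i)) * h1

theorem ratioRel_one {x y : R} : RatioRel 1 x y ↔ y = x := by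
  simp only [RatioRel, ratios, Equiv.Perm.one_apply]
  constructor <;> intro h <;> simp at * <;> linear_combination h

theorem ratioRel_swap_zero_one {x y : R} : RatioRel (Equiv.swap 0 1) x y ↔ y = 1 - x := by
  simp only [RatioRel, ratios, Equiv.swap_apply_right,
    show (Equiv.swap (0 : Fin 3) 1) 2 = 2 by decide]
  constructor <;> intro h <;> simp at * <;> linear_combination h

theorem ratioRel_swap_one_two {x y : R} : RatioRel (Equiv.swap 1 2) x y ↔ x * y = 1 := by
  simp only [RatioRel, ratios, Equiv.swap_apply_right, Equiv.swap_apply_left]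
  constructor <;> intro h <;> simp at * <;> linear_combination -h

theorem ratioRel_swap_zero_two {x y : R} :
    RatioRel (Equiv.swap 0 2) x y ↔ (1 - x) * (1 - y) = 1 := by
  simp only [RatioRel, ratios, Equiv.swap_apply_right,
    show (Equiv.swap (0 : Fin 3) 2) 1 = 1 by decide]
  constructor <;> intro h <;> simp at * <;> linear_combination h

theorem ratioRel_cycle {x y : R} :
    RatioRel (Equiv.swap 0 1 * Equiv.swap 1 2) x y ↔ (1 - x) * y = 1 := by
  simp only [RatioRel, ratios,
    show (Equiv.swap 0 1 * Equiv.swap 1 2 : Equiv.Perm (Fin 3)) 1 = 2 by decide,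
    show (Equiv.swap 0 1 * Equiv.swap 1 2 : Equiv.Perm (Fin 3)) 2 = 0 by decide]
  constructor <;> intro h <;> simp at * <;> linear_combination -h

theorem ratioRel_cycle' {x y : R} :
    RatioRel (Equiv.swap 1 2 * Equiv.swap 0 1) x y ↔ x * (1 - y) = 1 := by
  simp only [RatioRel, ratios,
    show (Equiv.swap 1 2 * Equiv.swap 0 1 : Equiv.Perm (Fin 3)) 1 = 0 by decide,
    show (Equiv.swap 1 2 * Equiv.swap 0 1 : Equiv.Perm (Fin 3)) 2 = 1 by decide]
  constructor <;> intro h <;> simp at * <;> linear_combination h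

theorem mul_eq_one_iff_eq_inv {n : ℕ} {x y : ZMod n} : x * y = 1 ↔ IsUnit x ∧ y = x⁻¹ := by
  constructor
  · intro h
    have hx : IsUnit x := .of_mul_eq_one y h
    exact ⟨hx, by rw [← one_mul y, ← ZMod.inv_mul_of_unit x hx, mul_assoc, h, mul_one]⟩
  · rintro ⟨hx, rfl⟩
    exact ZMod.mul_inv_of_unit x hx

theorem mem_sixClass_iff {n : ℕ} {x y : ZMod n} :
    y ∈ sixClass x ↔ ∃ σ, RatioRel σ x y := by
  have e1 : IsUnit x ∧ y = 1 - x⁻¹ ↔ x * (1 - y) = 1 := by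
    rw [mul_eq_one_iff_eq_inv, sub_eq_iff_eq_add, eq_comm (a := (1 : ZMod n)), ← eq_sub_iff_add_eq']
  have e2 : IsUnit (x - 1) ∧ y = x * (x - 1)⁻¹ ↔ (1 - x) * (1 - y) = 1 := by
    have : (1 - x) * (1 - y) = (x - 1) * (y - 1) := by ring
    rw [this, mul_eq_one_iff_eq_inv]
    refine and_congr_right fun hx => ?_
    have := ZMod.mul_inv_of_unit _ hx
    exact ⟨fun h => by linear_combination h + this, fun h => by linear_combination h - this⟩
  rw [sixClass, Set.mem_ofPred_eq, ← mul_eq_one_iff_eq_inv, ← mul_eq_one_iff_eq_inv, e1, e2]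
  constructor
  · rintro (h | h | h | h | h | h)
    exacts [⟨_, ratioRel_one.2 h⟩, ⟨_, ratioRel_swap_one_two.2 h⟩, ⟨_, ratioRel_swap_zero_one.2 h⟩,
      ⟨_, ratioRel_cycle.2 h⟩, ⟨_, ratioRel_cycle'.2 h⟩, ⟨_, ratioRel_swap_zero_two.2 h⟩]
  · rintro ⟨σ, h⟩
    rcases perm_fin_three σ with rfl | rfl | rfl | rfl | rfl | rfl
    · exact .inl (ratioRel_one.1 h)
    · exact .inr (.inr (.inl (ratioRel_swap_zero_one.1 h)))
    · exact .inr (.inl (ratioRel_swap_one_two.1 h))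
    · exact .inr (.inr (.inr (.inr (.inr (ratioRel_swap_zero_two.1 h)))))
    · exact .inr (.inr (.inr (.inl (ratioRel_cycle.1 h))))
    · exact .inr (.inr (.inr (.inr (.inl (ratioRel_cycle'.1 h)))))

theorem mem_threeClass_iff {n : ℕ} {x y : ZMod n} :
    y ∈ threeClass x ↔ ∃ σ, Equiv.Perm.sign σ = 1 ∧ RatioRel σ x y := by
  have e1 : IsUnit x ∧ y = 1 - x⁻¹ ↔ x * (1 - y) = 1 := by
    rw [mul_eq_one_iff_eq_inv, sub_eq_iff_eq_add, eq_comm (a := (1 : ZMod n)), ← eq_sub_iff_add_eq']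
  rw [threeClass, Set.mem_ofPred_eq, ← mul_eq_one_iff_eq_inv, e1]
  constructor
  · rintro (h | h | h)
    exacts [⟨_, by decide, ratioRel_one.2 h⟩, ⟨_, by decide, ratioRel_cycle'.2 h⟩,
      ⟨_, by decide, ratioRel_cycle.2 h⟩]
  · rintro ⟨σ, hσ, h⟩
    rcases perm_fin_three σ with rfl | rfl | rfl | rfl | rfl | rfl
    · exact .inl (ratioRel_one.1 h)
    · exact absurd hσ (by decide)
    · exact absurd hσ (by decide)
    · exact absurd hσ (by decide)
    · exact .inr (.inr (ratioRel_cycle.1 h))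
    · exact .inr (.inl (ratioRel_cycle'.1 h))

/-- The points 0, 1, ∞ form one orbit on the projective line, and ∞ is no element of the ring. This
is the orbit excluded by m ≥ 2 in the list. -/
theorem RatioRel.eq_zero_or_one {x : R} {σ : Equiv.Perm (Fin 3)} [Nontrivial R]
    (h : RatioRel σ 0 x) : x = 0 ∨ x = 1 := by
  rcases perm_fin_three σ with rfl | rfl | rfl | rfl | rfl | rfl
  · exact .inl (ratioRel_one.1 h)
  · exact .inr (by simpa using ratioRel_swap_zero_one.1 h)
  · simpa using ratioRel_swap_one_two.1 h
  · exact .inl (by simpa using ratioRel_swap_zero_two.1 h)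
  · exact .inr (by simpa using ratioRel_cycle.1 h)
  · simpa using ratioRel_cycle'.1 h

end Ratios

/-! ### Normal forms and the moves between them -/

section NormalForm

variable {p α : ℕ} [hp : Fact p.Prime]

/-- The family `0, (0, p^s), (k p^t, p^s m)` of points of `(ℤ/p^α)²`. -/
def normalForm (p α s t : ℕ) (k m : ℤ) : Fin 3 → ZMod (p ^ α) × ZMod (p ^ α) :=
  ![(0, 0), (0, (p : ZMod (p ^ α)) ^ s), (k * (p : ZMod (p ^ α)) ^ t, (p : ZMod (p ^ α)) ^ s * m)]

theorem pow_mul_intCast_eq_zero_iff {i : ℕ} {x : ℤ} :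
    (p : ZMod (p ^ α)) ^ i * x = 0 ↔ (p : ℤ) ^ (α - i) ∣ x := by
  have h1 : (p : ZMod (p ^ α)) ^ i * x = ((p ^ i * x : ℤ) : ZMod (p ^ α)) := by push_cast; rfl
  have hp0 : (p : ℤ) ≠ 0 := by exact_mod_cast hp.out.ne_zero
  rw [h1, ZMod.intCast_zmod_eq_zero_iff_dvd]
  push_cast
  rcases le_total i α with h | h
  · conv_lhs => rw [← Nat.add_sub_of_le h, pow_add]
    exact mul_dvd_mul_iff_left (pow_ne_zero _ hp0)
  · rw [Nat.sub_eq_zero_of_le h, pow_zero]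
    exact ⟨fun _ => one_dvd _, fun _ => (pow_dvd_pow _ h).mul_right _⟩

theorem isUnit_intCast_of_not_dvd {k : ℤ} (hk : ¬ (p : ℤ) ∣ k) : IsUnit (k : ZMod (p ^ α)) := by
  have hpp : Prime (p : ℤ) := Nat.prime_iff_prime_int.1 hp.out
  have : IsCoprime ((p : ℤ) ^ α) k := ((Prime.coprime_iff_not_dvd hpp).2 hk).pow_left
  obtain ⟨u, v, h⟩ := this
  have h2 : ((u * (p : ℤ) ^ α + v * k : ℤ) : ZMod (p ^ α)) = 1 := by rw [h]; simp
  have h3 : ((p : ZMod (p ^ α)) ^ α) = 0 := by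
    rw [← Nat.cast_pow, ZMod.natCast_self]
  push_cast at h2
  rw [h3, mul_zero, zero_add] at h2
  exact .of_mul_eq_one_right _ h2

theorem exists_eq_intCast_mul_pow (x : ZMod (p ^ α)) :
    ∃ i ≤ α, ∃ k : ℤ, ¬ (p : ℤ) ∣ k ∧ x = k * (p : ZMod (p ^ α)) ^ i := by
  have h3 : ((p : ZMod (p ^ α)) ^ α) = 0 := by
    rw [← Nat.cast_pow, ZMod.natCast_self]
  have hpp : Prime (p : ℤ) := Nat.prime_iff_prime_int.1 hp.out
  obtain ⟨n, rfl⟩ := ZMod.intCast_surjective x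
  by_cases hn : n = 0
  · exact ⟨α, le_rfl, 1, hpp.not_dvd_one, by simp [hn, h3]⟩
  · obtain ⟨k, hn', hk⟩ := (FiniteMultiplicity.of_prime_left hpp hn).exists_eq_pow_mul_and_not_dvd
    generalize multiplicity (p : ℤ) n = i at hn'
    subst hn'
    rcases le_total i α with h | h
    · exact ⟨i, h, k, hk, by push_cast; ring⟩
    · refine ⟨α, le_rfl, k, hk, ?_⟩
      push_cast
      rw [← Nat.add_sub_of_le h, pow_add, h3]
      simp

theorem intCast_eq_iff_pow_mul_eq {i : ℕ} {x y : ℤ} :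
    (x : ZMod (p ^ (α - i))) = y ↔ (p : ZMod (p ^ α)) ^ i * x = p ^ i * y := by
  rw [← sub_eq_zero (a := (p : ZMod (p ^ α)) ^ i * x), ← mul_sub, ← Int.cast_sub,
    pow_mul_intCast_eq_zero_iff, eq_comm, ZMod.intCast_eq_intCast_iff_dvd_sub]
  push_cast
  rfl

/-- Multiplication by a unit on the multiples of `p^t`, transported to every coset. -/
def cosetMul (t : ℕ) (u x : ZMod (p ^ α)) : ZMod (p ^ α) :=
  (x.val % p ^ t : ℕ) + u * (x - (x.val % p ^ t : ℕ))

theorem exists_sub_mod_eq (t : ℕ) (x : ZMod (p ^ α)) :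
    ∃ y : ZMod (p ^ α), x - (x.val % p ^ t : ℕ) = p ^ t * y := by
  refine ⟨(x.val / p ^ t : ℕ), ?_⟩
  have := congrArg (Nat.cast : ℕ → ZMod (p ^ α)) (Nat.mod_add_div x.val (p ^ t))
  rw [Nat.cast_add, ZMod.natCast_zmod_val] at this
  push_cast at this
  rw [sub_eq_iff_eq_add', this]

theorem mod_val_add_pow_mul {t : ℕ} (ht : t ≤ α) (x y : ZMod (p ^ α)) :
    (x + p ^ t * y).val % p ^ t = x.val % p ^ t := by
  have : ((x + p ^ t * y : ZMod (p ^ α))) = ((x.val + p ^ t * y.val : ℕ) : ZMod (p ^ α)) := by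
    simp
  rw [this, ZMod.val_natCast, Nat.mod_mod_of_dvd _ (pow_dvd_pow p ht)]
  simp

theorem cosetMul_add {t : ℕ} (ht : t ≤ α) (u x y : ZMod (p ^ α)) :
    cosetMul t u (x + p ^ t * y) = cosetMul t u x + u * (p ^ t * y) := by
  rw [cosetMul, cosetMul, mod_val_add_pow_mul ht]
  ring

theorem cosetMul_cosetMul {t : ℕ} (ht : t ≤ α) {u v : ZMod (p ^ α)} (huv : u * v = 1)
    (x : ZMod (p ^ α)) : cosetMul t u (cosetMul t v x) = x := by
  obtain ⟨y, hy⟩ := exists_sub_mod_eq t x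
  have h1 : cosetMul t v x = x + p ^ t * ((v - 1) * y) := by
    rw [cosetMul, hy]
    linear_combination -hy
  rw [h1, cosetMul_add ht, cosetMul, hy]
  linear_combination (p ^ t * y) * huv - hy

/-- `cosetMul` as a permutation. -/
def cosetPerm {t : ℕ} (ht : t ≤ α) (u : (ZMod (p ^ α))ˣ) : Equiv.Perm (ZMod (p ^ α)) where
  toFun := cosetMul t u
  invFun := cosetMul t ↑u⁻¹
  left_inv := cosetMul_cosetMul ht (Units.inv_mul u)
  right_inv := cosetMul_cosetMul ht (Units.mul_inv u)

/-- The permutation multiplies by k'/k inside each coset of p^t, so it turns translation by k p^t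
into translation by k' p^t. It moves j by a multiple of p^t (k'/k - 1), which p^s annihilates by the
congruence; hence it commutes with the powers of Z^(p^s). It need not be affine, so this move goes
beyond the linear ones. -/
theorem normalForm_congr_left {s t : ℕ} {k k' m : ℤ} (ht : t ≤ α) (hk : ¬ (p : ℤ) ∣ k)
    (hk' : ¬ (p : ℤ) ∣ k') (h : (k : ZMod (p ^ (α - s - t))) = k') :
    OrdEquiv (normalForm p α s t k m) (normalForm p α s t k' m) := by
  obtain ⟨u, hu⟩ := isUnit_intCast_of_not_dvd (α := α) hk
  obtain ⟨u', hu'⟩ := isUnit_intCast_of_not_dvd (α := α) hk'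
  rw [Nat.sub_sub, intCast_eq_iff_pow_mul_eq, ← hu, ← hu', pow_add] at h
  have huu : (u : ZMod (p ^ α)) * ↑u⁻¹ = 1 := Units.mul_inv u
  have hperm : ∀ j, cosetPerm ht (u' * u⁻¹) j =
      cosetMul t ((u' : ZMod (p ^ α)) * (↑u⁻¹ : ZMod (p ^ α))) j :=
    fun j => by rw [← Units.val_mul]; rfl
  have hmul : ∀ j, (p : ZMod (p ^ α)) ^ s * cosetPerm ht (u' * u⁻¹) j = p ^ s * j := by
    intro j
    obtain ⟨y, hy⟩ := exists_sub_mod_eq t j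
    rw [hperm, cosetMul, hy]
    linear_combination (-(p : ZMod (p ^ α)) ^ s) * hy - y * (↑u⁻¹ : ZMod (p ^ α)) * h
      + (p ^ s * p ^ t * y) * huu
  refine ordEquiv_of_monomial (cosetPerm ht (u' * u⁻¹)) (D := fun _ => 1) (by simp) ?_ ?_
  · intro i j
    fin_cases i
    · simp [normalForm]
    · simp [normalForm]
    · simp only [normalForm, Fin.reduceFinMk, Matrix.cons_val, hperm]
      rw [← hu, ← hu', mul_comm (u : ZMod (p ^ α)), cosetMul_add ht]
      linear_combination (u' * p ^ t) * huu
  · intro i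
    refine ⟨1, by simp, fun j => ?_⟩
    rw [one_mul, mul_one, one_mul]
    congr 1
    fin_cases i
    · simp [normalForm]
    · simp [normalForm, hmul]
    · simp only [normalForm, Fin.reduceFinMk, Matrix.cons_val]
      linear_combination (-(m : ZMod (p ^ α))) * hmul j

/-- A shear with coefficient y/k adds p^t y = p^s p^(t-s) y to the second coordinate of the third
point and fixes the other two points. -/
theorem normalForm_congr_right {s t : ℕ} {k m m' : ℤ} (hst : s ≤ t) (hk : ¬ (p : ℤ) ∣ k)
    (h : (m : ZMod (p ^ (t - s))) = m') :
    OrdEquiv (normalForm p α s t k m) (normalForm p α s t k m') := by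
  obtain ⟨u, hu⟩ := isUnit_intCast_of_not_dvd (α := α) hk
  have huu : (u : ZMod (p ^ α)) * ↑u⁻¹ = 1 := Units.mul_inv u
  rw [ZMod.intCast_eq_intCast_iff_dvd_sub] at h
  obtain ⟨y, hy⟩ := h
  have hm : m' = m + p ^ (t - s) * y := by push_cast at hy; linarith
  have key := ordEquiv_shear (normalForm p α s t k m) ((↑u⁻¹ : ZMod (p ^ α)) * y)
  convert key using 1
  funext i
  fin_cases i
  · simp [normalForm]
  · simp [normalForm]
  · simp only [normalForm, Fin.reduceFinMk, Matrix.cons_val, hm, Prod.mk.injEq, true_and]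
    rw [← hu]
    push_cast
    have hpow : (p : ZMod (p ^ α)) ^ s * p ^ (t - s) = p ^ t := by
      rw [← pow_add, Nat.add_sub_of_le hst]
    linear_combination (y : ZMod (p ^ α)) * hpow - (y * p ^ t : ZMod (p ^ α)) * huu

/-- Exchange the first two points, translate the new first one to the origin, and apply -1. -/
theorem normalForm_one_sub {s t : ℕ} {k m : ℤ} :
    FamEquiv (normalForm p α s t k m) (normalForm p α s t (-k) (1 - m)) := by
  refine (famEquiv_comp _ (Equiv.swap 0 1)).symm.trans ?_
  have key := (ordEquiv_translate (normalForm p α s t k m ∘ Equiv.swap 0 1)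
    (0, (p : ZMod (p ^ α)) ^ s)).trans (ordEquiv_scale _ (-1))
  convert key.famEquiv using 1
  funext i
  fin_cases i
  · simp [normalForm]
  · simp [normalForm]
  · simp [normalForm, show (Equiv.swap (0 : Fin 3) 1) 2 = 2 by decide, mul_sub, neg_add_eq_sub]

/-- Exchange the last two points; when m is a unit, the upper triangular matrix with diagonal (m,
m⁻¹) and corner -k p^(t-s) takes the new second point (k p^t, p^s m) to (0, p^s). -/
theorem normalForm_inv {s t : ℕ} {k m m' : ℤ} (hst : s ≤ t) (ht : t ≤ α) (hk : ¬ (p : ℤ) ∣ k)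
    (h : (m * m' : ZMod (p ^ (t - s))) = 1) :
    FamEquiv (normalForm p α s t k m) (normalForm p α s t (-k) m') := by
  wlog hm : ¬ (p : ℤ) ∣ m generalizing m
  -- If p divides m, invertibility of m forces the modulus p^(t-s) to be 1, so m may be replaced by
  -- 1.
  · have hts : t - s = 0 := by
      by_contra h0
      rw [not_not] at hm
      have h1 : ((m * m' : ℤ) : ZMod (p ^ (t - s))) = (1 : ℤ) := by push_cast; exact h
      rw [ZMod.intCast_eq_intCast_iff_dvd_sub] at h1
      have hpp : Prime (p : ℤ) := Nat.prime_iff_prime_int.1 hp.out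
      have h2 : (p : ℤ) ∣ 1 - m * m' :=
        (dvd_pow_self (p : ℤ) h0).trans (by exact_mod_cast h1)
      exact hpp.not_dvd_one ((dvd_sub_left (hm.mul_right m')).1 h2)
    have hsub : ∀ x y : ZMod (p ^ (t - s)), x = y := by
      rw [hts, pow_zero]; exact fun x y => Subsingleton.elim _ _
    have hpp : Prime (p : ℤ) := Nat.prime_iff_prime_int.1 hp.out
    exact (normalForm_congr_right hst hk (hsub _ _)).famEquiv.trans
      (this (m := 1) (hsub _ _) hpp.not_dvd_one)
  obtain ⟨u, hu⟩ := isUnit_intCast_of_not_dvd (α := α) hm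
  have huu : (u : ZMod (p ^ α)) * ↑u⁻¹ = 1 := Units.mul_inv u
  obtain ⟨v, hv⟩ := ZMod.intCast_surjective (↑u⁻¹ : ZMod (p ^ α))
  have hvm' : ((v : ℤ) : ZMod (p ^ (t - s))) = m' := by
    have h1 : ((m * v : ℤ) : ZMod (p ^ α)) = (1 : ℤ) := by
      push_cast; rw [hv, ← hu, huu]
    have h2 : ((m * v : ℤ) : ZMod (p ^ (t - s))) = (1 : ℤ) := by
      rw [ZMod.intCast_eq_intCast_iff_dvd_sub] at h1 ⊢
      refine dvd_trans ?_ h1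
      exact_mod_cast pow_dvd_pow p ((Nat.sub_le t s).trans ht)
    push_cast at h2
    linear_combination (-(v : ZMod (p ^ (t - s)))) * h + (m' : ZMod (p ^ (t - s))) * h2
  refine FamEquiv.trans ?_ (normalForm_congr_right (m := v) hst (by rwa [dvd_neg]) hvm').famEquiv
  refine (famEquiv_comp _ (Equiv.swap 1 2)).symm.trans ?_
  have key := ordEquiv_linear (normalForm p α s t k m ∘ Equiv.swap 1 2)
    (A := u) (B := -k * (p : ZMod (p ^ α)) ^ (t - s)) (C := 0) (D := (↑u⁻¹ : ZMod (p ^ α)))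
    (.inl u.isUnit) (by rw [huu]; ring)
  convert key.famEquiv using 1
  have hpow : (p : ZMod (p ^ α)) ^ s * p ^ (t - s) = p ^ t := by
    rw [← pow_add, Nat.add_sub_of_le hst]
  funext i
  fin_cases i
  · simp [normalForm, show (Equiv.swap (1 : Fin 3) 2) 0 = 0 by decide]
  · simp only [normalForm, Fin.mk_one, Matrix.cons_val, Function.comp_apply,
      Equiv.swap_apply_left, Prod.mk.injEq, ← hu]
    exact ⟨by linear_combination ((k : ZMod (p ^ α)) * u) * hpow,
      by linear_combination -((p : ZMod (p ^ α)) ^ s) * huu⟩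
  · simp only [normalForm, Fin.reduceFinMk, Matrix.cons_val, Function.comp_apply,
      Equiv.swap_apply_right, Prod.mk.injEq, hv]
    push_cast
    exact ⟨by linear_combination (k : ZMod (p ^ α)) * hpow, by ring⟩

end NormalForm

/-! ### Reduction to normal form and its complete invariants -/

section Classification

variable {p α : ℕ} [hp : Fact p.Prime]

theorem normalForm_congr {s t : ℕ} {k k' m m' : ℤ} (hst : s ≤ t) (ht : t ≤ α)
    (hk : ¬ (p : ℤ) ∣ k) (hk' : ¬ (p : ℤ) ∣ k') (h : (k : ZMod (p ^ (α - s - t))) = k')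
    (hm : (m : ZMod (p ^ (t - s))) = m') :
    FamEquiv (normalForm p α s t k m) (normalForm p α s t k' m') :=
  ((normalForm_congr_right hst hk hm).trans (normalForm_congr_left ht hk hk' h)).famEquiv

/-- The moves m ↦ 1 - m and m ↦ 1/m generate S₃, and each changes the sign of k, as a transposition
should. -/
theorem famEquiv_normalForm_of_ratioRel {s t : ℕ} {k k' m m' : ℤ} {σ : Equiv.Perm (Fin 3)}
    (hst : s ≤ t) (ht : t ≤ α) (hk : ¬ (p : ℤ) ∣ k) (hk' : ¬ (p : ℤ) ∣ k')
    (h : (k : ZMod (p ^ (α - s - t))) = ((Equiv.Perm.sign σ : ℤ) * k' : ℤ))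
    (hm : RatioRel σ (m : ZMod (p ^ (t - s))) m') :
    FamEquiv (normalForm p α s t k m) (normalForm p α s t k' m') := by
  have hk0 : ¬ (p : ℤ) ∣ -k := by rwa [dvd_neg]
  rcases perm_fin_three σ with rfl | rfl | rfl | rfl | rfl | rfl
  · refine normalForm_congr hst ht hk hk' (by simpa using h) (ratioRel_one.1 hm).symm
  · refine normalForm_one_sub.trans (normalForm_congr hst ht hk0 hk' ?_ ?_)
    · rw [Int.cast_neg, h, ← Int.cast_neg]; simp
    · rw [ratioRel_swap_zero_one.1 hm]; push_cast; rfl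
  · refine (normalForm_inv hst ht hk (ratioRel_swap_one_two.1 hm)).trans
      (normalForm_congr hst ht hk0 hk' ?_ rfl)
    rw [Int.cast_neg, h, ← Int.cast_neg]; simp
  · have h1 := ratioRel_swap_zero_two.1 hm
    refine normalForm_one_sub.trans ((normalForm_inv (m' := 1 - m') hst ht hk0 ?_).trans
      (normalForm_one_sub.trans (normalForm_congr hst ht (by rwa [dvd_neg, dvd_neg]) hk' ?_ ?_)))
    · push_cast; exact h1
    · rw [neg_neg, Int.cast_neg, h, ← Int.cast_neg]; simp
    · push_cast; ring
  · have h1 := ratioRel_cycle.1 hm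
    refine normalForm_one_sub.trans ((normalForm_inv (m' := m') hst ht hk0 ?_).trans
      (normalForm_congr hst ht (by rwa [dvd_neg]) hk' ?_ rfl))
    · push_cast; exact h1
    · rw [neg_neg, h]; simp
  · have h1 := ratioRel_cycle'.1 hm
    refine (normalForm_inv (m' := 1 - m') hst ht hk ?_).trans
      (normalForm_one_sub.trans (normalForm_congr hst ht (by rwa [dvd_neg]) hk' ?_ ?_))
    · push_cast; exact h1
    · rw [neg_neg, h]; simp
    · push_cast; ring

theorem exists_eq_pow_smul_primitive (v : ZMod (p ^ α) × ZMod (p ^ α)) :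
    ∃ s ≤ α, ∃ x z : ZMod (p ^ α), (IsUnit x ∨ IsUnit z) ∧
      v = ((p : ZMod (p ^ α)) ^ s * x, (p : ZMod (p ^ α)) ^ s * z) := by
  obtain ⟨i, hi, k, hk, h1⟩ := exists_eq_intCast_mul_pow v.1
  obtain ⟨j, hj, l, hl, h2⟩ := exists_eq_intCast_mul_pow v.2
  rcases le_total i j with hij | hij
  · refine ⟨i, hi, k, l * p ^ (j - i), .inl (isUnit_intCast_of_not_dvd hk), Prod.ext ?_ ?_⟩
    · rw [h1, mul_comm]
    · rw [h2]
      nth_rw 1 [← Nat.add_sub_of_le hij]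
      rw [pow_add]
      ring
  · refine ⟨j, hj, k * p ^ (i - j), l, .inr (isUnit_intCast_of_not_dvd hl), Prod.ext ?_ ?_⟩
    · rw [h1]
      nth_rw 1 [← Nat.add_sub_of_le hij]
      rw [pow_add]
      ring
    · rw [h2, mul_comm]

/-- The primitive vector (x, z) is completed to the determinant one matrix with rows (z, -x) and (c,
e), which sends it to (0, 1). Since cx + ez = 1 in a local ring, z or c is a unit, as
`ordEquiv_linear` requires. -/
theorem exists_normalForm_of_le {a : Fin 3 → ZMod (p ^ α) × ZMod (p ^ α)} {s s' : ℕ}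
    (hs : s < α) (hss : s ≤ s') {x z x' z' : ZMod (p ^ α)} (hxz : IsUnit x ∨ IsUnit z)
    (h1 : a 1 - a 0 = ((p : ZMod (p ^ α)) ^ s * x, (p : ZMod (p ^ α)) ^ s * z))
    (h2 : a 2 - a 0 = ((p : ZMod (p ^ α)) ^ s' * x', (p : ZMod (p ^ α)) ^ s' * z')) :
    ∃ t : ℕ, ∃ k m : ℤ, s ≤ t ∧ t ≤ α ∧ ¬ (p : ℤ) ∣ k ∧ FamEquiv a (normalForm p α s t k m) := by
  obtain ⟨c, e, hce⟩ : ∃ c e : ZMod (p ^ α), c * x + e * z = 1 := by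
    rcases hxz with h | h
    · obtain ⟨c, hc⟩ := h.exists_left_inv
      exact ⟨c, 0, by rw [hc]; ring⟩
    · obtain ⟨e, he⟩ := h.exists_left_inv
      exact ⟨0, e, by rw [he]; ring⟩
  have hzc : IsUnit z ∨ IsUnit c := by
    have : IsLocalRing (ZMod (p ^ α)) := by
      have : Fact (1 < p ^ α) := ⟨Nat.one_lt_pow (by omega) hp.out.one_lt⟩
      have : Nontrivial (ZMod (p ^ α)) := inferInstance
      refine IsLocalRing.of_isUnit_or_isUnit_one_sub_self fun y => ?_
      obtain ⟨n, rfl⟩ := ZMod.intCast_surjective y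
      by_cases hn : (p : ℤ) ∣ n
      · right
        have hpp : Prime (p : ℤ) := Nat.prime_iff_prime_int.1 hp.out
        have := isUnit_intCast_of_not_dvd (p := p) (α := α) (k := 1 - n)
          fun h => hpp.not_dvd_one ((dvd_sub_left hn).1 h)
        simpa using this
      · exact .inl (isUnit_intCast_of_not_dvd hn)
    rcases IsLocalRing.isUnit_or_isUnit_of_add_one hce with h | h
    · exact .inr (isUnit_of_mul_isUnit_left h)
    · exact .inl (isUnit_of_mul_isUnit_right h)
  have key := (ordEquiv_translate a (a 0)).trans
    (ordEquiv_linear _ (A := z) (B := -x) (C := c) (D := e) hzc (by linear_combination hce))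
  obtain ⟨j, hj, k, hk, hkj⟩ := exists_eq_intCast_mul_pow
    ((p : ZMod (p ^ α)) ^ (s' - s) * (z * x' - x * z'))
  obtain ⟨m, hm⟩ := ZMod.intCast_surjective
    ((p : ZMod (p ^ α)) ^ (s' - s) * (c * x' + e * z'))
  have hpow : (p : ZMod (p ^ α)) ^ s * p ^ (s' - s) = p ^ s' := by
    rw [← pow_add, Nat.add_sub_of_le hss]
  -- The exponent is truncated at α, where the power of p is already zero.
  have hpow' : (p : ZMod (p ^ α)) ^ (min (s + j) α) = p ^ s * p ^ j := by
    have h0 : (p : ZMod (p ^ α)) ^ α = 0 := by rw [← Nat.cast_pow, ZMod.natCast_self]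
    rcases le_total (s + j) α with h | h
    · rw [min_eq_left h, pow_add]
    · rw [min_eq_right h, ← pow_add, h0, ← Nat.add_sub_of_le h, pow_add, h0, zero_mul]
  refine ⟨min (s + j) α, k, m, le_min (by omega) hs.le, min_le_right _ _, hk, ?_⟩
  convert key.famEquiv using 1
  funext i
  fin_cases i
  · simp [normalForm]
  · simp only [normalForm, Fin.mk_one, Matrix.cons_val, h1, Prod.mk.injEq]
    exact ⟨by ring, by linear_combination (-(p : ZMod (p ^ α)) ^ s) * hce⟩
  · simp only [normalForm, Fin.reduceFinMk, Matrix.cons_val, h2, Prod.mk.injEq, hpow', hm]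
    exact ⟨by linear_combination (-(p : ZMod (p ^ α)) ^ s) * hkj + (z * x' - x * z') * hpow,
      by linear_combination (c * x' + e * z') * hpow⟩

theorem exists_famEquiv_normalForm {a : Fin 3 → ZMod (p ^ α) × ZMod (p ^ α)}
    (ha : Function.Injective a) :
    ∃ s t : ℕ, ∃ k m : ℤ, s < α ∧ s ≤ t ∧ t ≤ α ∧ ¬ (p : ℤ) ∣ k ∧
      FamEquiv a (normalForm p α s t k m) := by
  have hlt : ∀ {i s x z}, i ≠ 0 → s ≤ α →
      a i - a 0 = ((p : ZMod (p ^ α)) ^ s * x, (p : ZMod (p ^ α)) ^ s * z) → s < α := by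
    intro i s x z hi hs h
    refine lt_of_le_of_ne hs ?_
    rintro rfl
    have h0 : (p : ZMod (p ^ s)) ^ s = 0 := by rw [← Nat.cast_pow, ZMod.natCast_self]
    rw [h0, zero_mul, zero_mul] at h
    exact hi (ha (sub_eq_zero.1 h))
  obtain ⟨s, hs, x, z, hxz, h1⟩ := exists_eq_pow_smul_primitive (a 1 - a 0)
  obtain ⟨s', hs', x', z', hxz', h2⟩ := exists_eq_pow_smul_primitive (a 2 - a 0)
  rcases le_total s s' with h | h
  · obtain ⟨t, k, m, h3⟩ := exists_normalForm_of_le (hlt (by decide) hs h1) h hxz h1 h2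
    exact ⟨s, t, k, m, hlt (by decide) hs h1, h3⟩
  · obtain ⟨t, k, m, h3, h4, h5, h6⟩ := exists_normalForm_of_le (a := a ∘ Equiv.swap 1 2)
      (hlt (by decide) hs' h2) h hxz' h2 h1
    exact ⟨s', t, k, m, hlt (by decide) hs' h2, h3, h4, h5, (famEquiv_comp a _).symm.trans h6⟩

theorem sum_smul_normalForm_eq_zero_iff {s t : ℕ} {k m : ℤ} (hk : ¬ (p : ℤ) ∣ k)
    (z : Fin 3 → ℤ) : ∑ i, (z i : ZMod (p ^ α)) • normalForm p α s t k m i = 0 ↔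
      (p : ℤ) ^ (α - t) ∣ z 2 ∧ (p : ℤ) ^ (α - s) ∣ z 1 + z 2 * m := by
  rw [← pow_mul_intCast_eq_zero_iff (α := α), ← pow_mul_intCast_eq_zero_iff (α := α),
    Fin.sum_univ_three, Prod.ext_iff]
  simp only [normalForm, Matrix.cons_val, Prod.smul_mk, Prod.mk_add_mk, smul_eq_mul, mul_zero,
    zero_add, Prod.fst_zero, Prod.snd_zero]
  refine and_congr ?_ ?_
  · rw [show (z 2 : ZMod (p ^ α)) * (k * p ^ t) = k * (p ^ t * z 2) by ring]
    exact (isUnit_intCast_of_not_dvd hk).mul_right_eq_zero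
  · push_cast
    rw [show (z 1 : ZMod (p ^ α)) * p ^ s + z 2 * (p ^ s * m) = p ^ s * (z 1 + z 2 * m) by ring]

theorem OrdEquiv.sum_smul_normalForm {s t s' t' : ℕ} {k m k' m' : ℤ} {σ : Equiv.Perm (Fin 3)}
    (hk : ¬ (p : ℤ) ∣ k) (hk' : ¬ (p : ℤ) ∣ k')
    (h : OrdEquiv (normalForm p α s t k m) (normalForm p α s' t' k' m' ∘ σ))
    {z : Fin 3 → ℤ} (hz : ∑ i, z i = 0) (h1 : (p : ℤ) ^ (α - t) ∣ z 2)
    (h2 : (p : ℤ) ^ (α - s) ∣ z 1 + z 2 * m) :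
    (p : ℤ) ^ (α - t') ∣ z (σ⁻¹ 2) ∧ (p : ℤ) ^ (α - s') ∣ z (σ⁻¹ 1) + z (σ⁻¹ 2) * m' := by
  have h3 := h.sum_smul_eq_zero (c := fun i => (z i : ZMod (p ^ α)))
    (by rw [← Int.cast_sum, hz, Int.cast_zero])
    ((sum_smul_normalForm_eq_zero_iff hk z).2 ⟨h1, h2⟩)
  rw [← Equiv.sum_comp σ⁻¹] at h3
  have h4 := (sum_smul_normalForm_eq_zero_iff (α := α) (s := s') (t := t') (m := m') hk'
    fun i => z (σ⁻¹ i)).1 (by simpa using h3)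
  exact h4

theorem pow_dvd_pow_iff_le {i j : ℕ} : (p : ℤ) ^ i ∣ (p : ℤ) ^ j ↔ i ≤ j := by
  have := Nat.pow_dvd_pow_iff_le_right hp.out.one_lt (k := i) (l := j)
  rw [← this]
  exact_mod_cast Iff.rfl

/-- Two relations valid for the source are transported: one detects s, the other t. Used in both
directions, this gives equality of the exponents. -/
theorem OrdEquiv.normalForm_le {s t s' t' : ℕ} {k m k' m' : ℤ} {σ : Equiv.Perm (Fin 3)}
    (hst : s ≤ t) (hs : s ≤ α) (ht : t ≤ α) (hst' : s' ≤ t')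
    (hk : ¬ (p : ℤ) ∣ k) (hk' : ¬ (p : ℤ) ∣ k')
    (h : OrdEquiv (normalForm p α s t k m) (normalForm p α s' t' k' m' ∘ σ)) :
    s ≤ s' ∧ t ≤ t' := by
  constructor
  -- All differences in the source are killed by p^(α-s). The coefficients are chosen so that in the
  -- target, after σ, exactly the difference (0, p^s') is tested.
  · have hdvd : ∀ i, (p : ℤ) ^ (α - s) ∣ (p : ℤ) ^ (α - s) * (![-1, 1, 0] : Fin 3 → ℤ) (σ i) :=
      fun i => dvd_mul_right _ _
    have h1 := h.sum_smul_normalForm hk hk'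
      (z := fun i => (p : ℤ) ^ (α - s) * (![-1, 1, 0] : Fin 3 → ℤ) (σ i))
      (by rw [← Finset.mul_sum, Equiv.sum_comp σ (![-1, 1, 0] : Fin 3 → ℤ)]
          simp [Fin.sum_univ_three])
      ((pow_dvd_pow _ (by omega)).trans (hdvd 2))
      (dvd_add (hdvd 1) ((hdvd 2).mul_right _))
    have h2 := h1.2
    simp only [← Equiv.Perm.mul_apply, mul_inv_cancel, Equiv.Perm.one_apply, Matrix.cons_val,
      mul_one, mul_zero, zero_mul, add_zero] at h2
    have := pow_dvd_pow_iff_le.1 h2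
    omega
  -- The transported relation makes p^(α-t') divide all three coefficients p^(α-t)(m-1), -p^(α-t)m
  -- and p^(α-t), in particular the last.
  · have h1 := h.sum_smul_normalForm hk hk'
      (z := fun i => (p : ℤ) ^ (α - t) * ratios m i)
      (by rw [← Finset.mul_sum, Fin.sum_univ_three]
          exact mul_eq_zero_of_right _ (sum_ratios m 1))
      (dvd_mul_right _ _) (by simp [ratios])
    obtain ⟨h2, h3⟩ := h1
    have h4 : (p : ℤ) ^ (α - t') ∣ (p : ℤ) ^ (α - t) * ratios m (σ⁻¹ 1) :=
      (dvd_add_left (h2.mul_right m')).1 ((pow_dvd_pow _ (by omega)).trans h3)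
    have h5 : (p : ℤ) ^ (α - t') ∣ (p : ℤ) ^ (α - t) * ratios m (σ⁻¹ 0) := by
      have := sum_ratios m σ⁻¹
      have e : (p : ℤ) ^ (α - t) * ratios m (σ⁻¹ 0) = -((p : ℤ) ^ (α - t) * ratios m (σ⁻¹ 1)
          + (p : ℤ) ^ (α - t) * ratios m (σ⁻¹ 2)) := by linear_combination (p : ℤ) ^ (α - t) * this
      rw [e, dvd_neg]
      exact dvd_add h4 h2
    have h6 : ∀ i, (p : ℤ) ^ (α - t') ∣ (p : ℤ) ^ (α - t) * ratios m (σ⁻¹ i) := by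
      intro i
      fin_cases i
      exacts [h5, h4, h2]
    have h7 := h6 (σ 2)
    simp only [← Equiv.Perm.mul_apply, inv_mul_cancel, Equiv.Perm.one_apply, ratios,
      Matrix.cons_val, mul_one] at h7
    have := pow_dvd_pow_iff_le.1 h7
    omega

theorem symp_comp_perm {d : ℕ} (b : Fin 3 → ZMod d × ZMod d) (σ : Equiv.Perm (Fin 3)) :
    symp (b (σ 1) - b (σ 0)) (b (σ 2) - b (σ 0))
      = ((Equiv.Perm.sign σ : ℤ) : ZMod d) * symp (b 1 - b 0) (b 2 - b 0) := by
  rcases perm_fin_three σ with rfl | rfl | rfl | rfl | rfl | rfl <;>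
  simp [symp, Equiv.swap_apply_def] <;> ring

/-- The orbit of m comes from a preserved affine relation, the class of k from the preserved
symplectic form p^(s+t) k. The same permutation governs both, which couples the sign of k to the
move on m. -/
theorem FamEquiv.normalForm_invariants {s t s' t' : ℕ} {k m k' m' : ℤ}
    (hst : s ≤ t) (ht : t ≤ α) (hst' : s' ≤ t') (ht' : t' ≤ α)
    (hk : ¬ (p : ℤ) ∣ k) (hk' : ¬ (p : ℤ) ∣ k')
    (h : FamEquiv (normalForm p α s t k m) (normalForm p α s' t' k' m')) :
    s = s' ∧ t = t' ∧ ∃ σ : Equiv.Perm (Fin 3), RatioRel σ (m : ZMod (p ^ (t - s))) m' ∧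
      (k : ZMod (p ^ (α - s - t))) = ((Equiv.Perm.sign σ : ℤ) * k' : ℤ) := by
  have hsym := h.symm
  obtain ⟨σ, h⟩ := h
  obtain ⟨τ, hτ⟩ := hsym
  have h1 := h.normalForm_le hst (hst.trans ht) ht hst' hk hk'
  have h2 := hτ.normalForm_le hst' (hst'.trans ht') ht' hst hk' hk
  obtain rfl : s = s' := le_antisymm h1.1 h2.1
  obtain rfl : t = t' := le_antisymm h1.2 h2.2
  refine ⟨rfl, rfl, σ⁻¹, ?_, ?_⟩
  · have h1 := (h.sum_smul_normalForm hk hk'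
      (z := fun i => (p : ℤ) ^ (α - t) * ratios m i)
      (by rw [← Finset.mul_sum, Fin.sum_univ_three]
          exact mul_eq_zero_of_right _ (sum_ratios m 1))
      (dvd_mul_right _ _) (by simp [ratios])).2
    have hp0 : (p : ℤ) ≠ 0 := by exact_mod_cast hp.out.ne_zero
    -- Cancelling the common factor p^(α-t) leaves a congruence modulo p^(t-s).
    rw [show α - s = (α - t) + (t - s) by omega, pow_add, mul_assoc, ← mul_add,
      mul_dvd_mul_iff_left (pow_ne_zero _ hp0)] at h1
    have h2 : ((ratios m (σ⁻¹ 1) + ratios m (σ⁻¹ 2) * m' : ℤ) : ZMod (p ^ (t - s))) = 0 := by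
      rw [ZMod.intCast_zmod_eq_zero_iff_dvd]
      exact_mod_cast h1
    have e : ∀ i, ((ratios m i : ℤ) : ZMod (p ^ (t - s))) = ratios (m : ZMod (p ^ (t - s))) i :=
      fun i => by fin_cases i <;> simp [ratios]
    rw [RatioRel, ← e, ← e]
    push_cast at h2
    exact h2
  · have h1 := h.symp_sub_eq 1 2 0
    simp only [Function.comp_apply, symp_comp_perm] at h1
    have e : ∀ k m : ℤ, symp (normalForm p α s t k m 1 - normalForm p α s t k m 0)
        (normalForm p α s t k m 2 - normalForm p α s t k m 0) = p ^ (s + t) * k := by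
      intro k m
      simp [normalForm, symp]
      ring
    rw [e, e] at h1
    rw [Nat.sub_sub, intCast_eq_iff_pow_mul_eq, Equiv.Perm.sign_inv, h1]
    push_cast
    ring

end Classification

/-! ### Minimal orbit representatives -/

/-- `m ∈ {2, …, n-1}` is minimal among its images under the permutations in `H`. -/
def IsMinOrbit (H : Subgroup (Equiv.Perm (Fin 3))) (n m : ℕ) : Prop :=
  2 ≤ m ∧ m < n ∧ ∀ σ ∈ H, ∀ y : ZMod n, RatioRel σ (m : ZMod n) y → m ≤ y.val

theorem natCast_ne_zero_and_ne_one {n m : ℕ} (h2 : 2 ≤ m) (hn : m < n) :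
    (m : ZMod n) ≠ 0 ∧ (m : ZMod n) ≠ 1 := by
  have : NeZero n := ⟨by omega⟩
  have : Fact (1 < n) := ⟨by omega⟩
  constructor
  · intro h
    have := congrArg ZMod.val h
    rw [ZMod.val_natCast_of_lt hn, ZMod.val_zero] at this
    omega
  · intro h
    have := congrArg ZMod.val h
    rw [ZMod.val_natCast_of_lt hn, ZMod.val_one] at this
    omega

theorem RatioRel.ne_zero_and_ne_one {n : ℕ} {x y : ZMod n} {σ : Equiv.Perm (Fin 3)}
    (h : RatioRel σ x y) (hx : x ≠ 0 ∧ x ≠ 1) : y ≠ 0 ∧ y ≠ 1 := by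
  have : Nontrivial (ZMod n) := ⟨⟨_, _, hx.1⟩⟩
  constructor
  · rintro rfl
    rcases h.symm.eq_zero_or_one with h | h
    exacts [hx.1 h, hx.2 h]
  · rintro rfl
    have h1 : RatioRel (Equiv.swap 0 1) (0 : ZMod n) 1 := ratioRel_swap_zero_one.2 (by ring)
    rcases (h1.trans h.symm).eq_zero_or_one with h | h
    exacts [hx.1 h, hx.2 h]

theorem two_le_val {n : ℕ} [NeZero n] {y : ZMod n} (hy : y ≠ 0 ∧ y ≠ 1) : 2 ≤ y.val := by
  have h0 : y.val ≠ 0 := fun h => hy.1 ((ZMod.val_eq_zero y).1 h)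
  have h1 : y.val ≠ 1 := fun h =>
    hy.2 (by rw [← ZMod.natCast_zmod_val y, h, Nat.cast_one])
  omega

/-- The relation composes within H, so an element minimal among the images of x is minimal among its
own images. The values 0 and 1 never arise from x ≠ 0, 1. -/
theorem exists_isLeast_iff {H : Subgroup (Equiv.Perm (Fin 3))} {n m : ℕ}
    {C : ZMod n → Set (ZMod n)} (hC : ∀ x y, y ∈ C x ↔ ∃ σ ∈ H, RatioRel σ x y) :
    (∃ x : ℕ, 2 ≤ x ∧ x < n ∧ IsLeast (ZMod.val '' C (x : ZMod n)) m) ↔ IsMinOrbit H n m := by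
  constructor
  · rintro ⟨x, h2, hx, ⟨y, hy, rfl⟩, hmin⟩
    have : NeZero n := ⟨by omega⟩
    obtain ⟨τ, hτ, hxy⟩ := (hC _ _).1 hy
    refine ⟨two_le_val (hxy.ne_zero_and_ne_one (natCast_ne_zero_and_ne_one h2 hx)),
      ZMod.val_lt y, fun σ hσ z hz => hmin ⟨z, (hC _ _).2 ⟨τ * σ, mul_mem hτ hσ, ?_⟩, rfl⟩⟩
    rw [ZMod.natCast_zmod_val] at hz
    exact hxy.trans hz
  · rintro ⟨h2, hn, h⟩
    refine ⟨m, h2, hn, ⟨m, (hC _ _).2 ⟨1, one_mem _, ratioRel_one.2 rfl⟩,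
      ZMod.val_natCast_of_lt hn⟩, ?_⟩
    rintro _ ⟨y, hy, rfl⟩
    obtain ⟨σ, hσ, hy⟩ := (hC _ _).1 hy
    exact h σ hσ y hy

theorem isMinSix_iff {n m : ℕ} : IsMinSix n m ↔ IsMinOrbit ⊤ n m :=
  exists_isLeast_iff fun x y => by simp [mem_sixClass_iff]

theorem isMinThree_iff {n m : ℕ} : IsMinThree n m ↔ IsMinOrbit (alternatingGroup (Fin 3)) n m :=
  exists_isLeast_iff fun x y => by simp [mem_threeClass_iff, Equiv.Perm.mem_alternatingGroup]

theorem exists_isMinOrbit (H : Subgroup (Equiv.Perm (Fin 3))) {n : ℕ} [NeZero n] {x : ZMod n}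
    (hx : x ≠ 0 ∧ x ≠ 1) : ∃ m, IsMinOrbit H n m ∧ ∃ σ ∈ H, RatioRel σ x (m : ZMod n) := by
  classical
  have hex : ∃ m : ℕ, ∃ y : ZMod n, y.val = m ∧ ∃ σ ∈ H, RatioRel σ x y :=
    ⟨_, x, rfl, 1, one_mem _, ratioRel_one.2 rfl⟩
  obtain ⟨y, hy, σ, hσ, hxy⟩ := Nat.find_spec hex
  have hym : ((Nat.find hex : ℕ) : ZMod n) = y := by rw [← hy, ZMod.natCast_zmod_val]
  refine ⟨Nat.find hex, ⟨?_, ?_, fun τ hτ z hz => ?_⟩, σ, hσ, by rwa [hym]⟩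
  · have := two_le_val (hxy.ne_zero_and_ne_one hx)
    rwa [hy] at this
  · have := ZMod.val_lt y
    rwa [hy] at this
  · rw [hym] at hz
    exact Nat.find_min' hex ⟨z, rfl, σ * τ, mul_mem hσ hτ, hxy.trans hz⟩

/-- Minimality is applied to σ on one side and to σ⁻¹ on the other, so the two subgroups need only
share this one permutation. -/
theorem IsMinOrbit.eq {H H' : Subgroup (Equiv.Perm (Fin 3))} {n m m' : ℕ}
    (h : IsMinOrbit H n m) (h' : IsMinOrbit H' n m') {σ : Equiv.Perm (Fin 3)} (hσ : σ ∈ H)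
    (hσ' : σ ∈ H') (hr : RatioRel σ (m : ZMod n) m') : m = m' := by
  refine le_antisymm ?_ ?_
  · have := h.2.2 σ hσ _ hr
    rwa [ZMod.val_natCast_of_lt h'.2.1] at this
  · have := h'.2.2 σ⁻¹ (inv_mem hσ') _ hr.symm
    rwa [ZMod.val_natCast_of_lt h.2.1] at this

theorem mem_alternatingGroup_of_eq {n k : ℕ} (hk : 1 ≤ k) (h : 2 * k < n)
    {σ : Equiv.Perm (Fin 3)}
    (hσ : ((k : ℤ) : ZMod (n)) = ((Equiv.Perm.sign σ : ℤ) * k : ℤ)) :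
    σ ∈ alternatingGroup (Fin 3) := by
  rw [Equiv.Perm.mem_alternatingGroup]
  rcases Int.units_eq_one_or (Equiv.Perm.sign σ) with h1 | h1
  · exact h1
  · exfalso
    rw [h1, eq_comm, ZMod.intCast_eq_intCast_iff_dvd_sub] at hσ
    simp only [Units.val_neg, Units.val_one, neg_mul, one_mul, sub_neg_eq_add] at hσ
    have h2 : n ∣ 2 * k := by
      rw [two_mul]
      exact_mod_cast hσ
    have := Nat.le_of_dvd (by omega) h2
    omega

theorem intCast_eq_of_add_ge {p α s t : ℕ} (h : α ≤ s + t) (x y : ℤ) :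
    (x : ZMod (p ^ (α - s - t))) = y := by
  have : α - s - t = 0 := by omega
  rw [this, pow_zero]
  exact Subsingleton.elim _ _

/-- The range up to n/2 contains one of each pair ±k; for the sign -1, n divides k + k' ≤ n, which
forces k = k' = n/2. -/
theorem eq_of_intCast_eq_sign_mul {n k k' : ℕ} (hk : 1 ≤ k) (hk' : 1 ≤ k') (h : 2 * k ≤ n)
    (h' : 2 * k' ≤ n) {ε : ℤˣ} (he : ((k : ℤ) : ZMod n) = ((ε : ℤ) * k' : ℤ)) : k = k' := by
  rw [eq_comm, ZMod.intCast_eq_intCast_iff_dvd_sub] at he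
  rcases Int.units_eq_one_or ε with rfl | rfl
  · simp only [Units.val_one, one_mul] at he
    have := Int.eq_zero_of_abs_lt_dvd he (by rw [abs_lt]; constructor <;> omega)
    omega
  · simp only [Units.val_neg, Units.val_one, neg_mul, one_mul, sub_neg_eq_add] at he
    have := Int.le_of_dvd (by omega) he
    omega

/-- The parameters `(s, t, k, m)` of the normal form that a label stands for. -/
def Label.params (α : ℕ) : Label → ℕ × ℕ × ℕ × ℕ
  | .fam1 s t => (s, t, 1, 0)
  | .fam2 k s t => (s, t, k, 0)
  | .fam3 s m => (s, α, 1, m)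
  | .fam4 k s t m => (s, t, k, m)
  | .fam41 k s t m => (s, t, k, m)
  | .fam42 k s t m => (s, t, k, m)
  | .fam5 s t m => (s, t, 1, m)

/-- The families are separated by m = 0 or m ≥ 2, by t = α or t < α, by the comparison of s + t with
α (or α - 1), and by whether p = 2. -/
theorem Label.eq_of_params_eq {p α : ℕ} {l l' : Label} (hl : l.Valid p α) (hl' : l'.Valid p α)
    (h : l.params α = l'.params α) : l = l' := by
  rcases l with ⟨s, t⟩ | ⟨k, s, t⟩ | ⟨s, m⟩ | ⟨k, s, t, m⟩ | ⟨k, s, t, m⟩ | ⟨k, s, t, m⟩ |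
    ⟨s, t, m⟩ <;>
  rcases l' with ⟨s, t⟩ | ⟨k, s, t⟩ | ⟨s, m⟩ | ⟨k, s, t, m⟩ | ⟨k, s, t, m⟩ | ⟨k, s, t, m⟩ |
    ⟨s, t, m⟩ <;>
  simp only [Label.params, Prod.mk.injEq, Label.Valid, isMinSix_iff, isMinThree_iff, IsMinOrbit]
    at h hl hl' <;>
  obtain ⟨rfl, h2, h3, h4⟩ := h <;>
  first
    | (exfalso; omega)
    | (subst h2 h3 h4; rfl)
    | (subst h2 h4; rfl)
    | (subst h2 h3; rfl)
    | (subst h2; rfl)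
    | (subst h4; rfl)

/-! ### Labels as canonical normal forms -/

section Labels

variable {p α : ℕ} [hp : Fact p.Prime]

/-- The normal form that a label stands for. -/
def Label.points (p α : ℕ) (l : Label) : Fin 3 → ZMod (p ^ α) × ZMod (p ^ α) :=
  normalForm p α (l.params α).1 (l.params α).2.1 (l.params α).2.2.1 (l.params α).2.2.2

theorem range_weyl_normalForm (s t k m : ℕ) :
    Set.range (weyl ∘ normalForm p α s t k m)
      = {1, clock (p ^ α) ^ p ^ s, shift (p ^ α) ^ (k * p ^ t) * clock (p ^ α) ^ (p ^ s * m)} := by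
  have h : ∀ f : Fin 3 → Matrix (ZMod (p ^ α)) (ZMod (p ^ α)) ℂ,
      Set.range f = {f 0, f 1, f 2} := fun f => by
    ext A
    simp [Fin.exists_fin_succ, eq_comm]
  rw [h, shift_pow_mul_clock_pow, clock_pow, ← weyl_zero]
  simp [normalForm]
  rfl

theorem Label.rep_eq {l : Label} (hl : l.Valid p α) :
    l.rep p (p ^ α) = Set.range (weyl ∘ l.points p α) := by
  rw [Label.points, range_weyl_normalForm]
  rcases l with ⟨s, t⟩ | ⟨k, s, t⟩ | ⟨s, m⟩ | ⟨k, s, t, m⟩ | ⟨k, s, t, m⟩ | ⟨k, s, t, m⟩ | ⟨s, t, m⟩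
  · simp [Label.rep, Label.params]
  · simp [Label.rep, Label.params]
  · have : shift (p ^ α) ^ p ^ α = 1 := by
      rw [shift_pow, ZMod.natCast_self, ← weyl_zero]
      rfl
    simp [Label.rep, Label.params, this]
  · simp [Label.rep, Label.params]
  · obtain rfl : p = 2 := hl.1
    simp [Label.rep, Label.params]
  · obtain rfl : p = 2 := hl.1
    simp [Label.rep, Label.params]
  · simp [Label.rep, Label.params]

/-- The parameters that represent their class canonically. -/
structure IsCanonical (p α : ℕ) (q : ℕ × ℕ × ℕ × ℕ) : Prop where
  lt : q.1 < α
  le : q.1 ≤ q.2.1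
  le' : q.2.1 ≤ α
  not_dvd : ¬ (p : ℤ) ∣ q.2.2.1
  pos : 1 ≤ q.2.2.1
  two_mul_le : q.1 + q.2.1 < α → 2 * q.2.2.1 ≤ p ^ (α - q.1 - q.2.1)
  eq_one : α ≤ q.1 + q.2.1 → q.2.2.1 = 1
  min : (q.2.2.2 = 0 ∧ q.2.1 < α) ∨ ∃ H, IsMinOrbit H (p ^ (q.2.1 - q.1)) q.2.2.2 ∧
    ∀ σ : Equiv.Perm (Fin 3), ((q.2.2.1 : ℤ) : ZMod (p ^ (α - q.1 - q.2.1))) =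
      ((Equiv.Perm.sign σ : ℤ) * q.2.2.1 : ℤ) → σ ∈ H

theorem not_dvd_of_coprime {k : ℕ} (h : k.Coprime p) : ¬ (p : ℤ) ∣ k := by
  intro h1
  have h2 : p ∣ k := by exact_mod_cast h1
  have := Nat.Coprime.eq_one_of_dvd h.symm h2
  exact hp.out.one_lt.ne' this

theorem Label.Valid.isCanonical {l : Label} (hl : l.Valid p α) : IsCanonical p α (l.params α) := by
  have hp1 : ¬ (p : ℤ) ∣ 1 := (Nat.prime_iff_prime_int.1 hp.out).not_dvd_one
  rcases l with ⟨s, t⟩ | ⟨k, s, t⟩ | ⟨s, m⟩ | ⟨k, s, t, m⟩ | ⟨k, s, t, m⟩ | ⟨k, s, t, m⟩ | ⟨s, t, m⟩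
  · obtain ⟨h1, h2, h3, h4⟩ := hl
    constructor <;> simp only [Label.params]
    · omega
    · omega
    · omega
    · exact_mod_cast hp1
    · exact le_rfl
    · omega
    · simp
    · exact .inl ⟨trivial, h3⟩
  · obtain ⟨h1, h2, h3, h4, h5, h6⟩ := hl
    constructor <;> simp only [Label.params]
    · omega
    · omega
    · omega
    · exact not_dvd_of_coprime h6
    · exact h4
    · exact fun _ => h5
    · omega
    · exact .inl ⟨trivial, h2⟩
  · obtain ⟨h1, h2⟩ := hl
    constructor <;> simp only [Label.params]
    · omega
    · omega
    · omega
    · exact_mod_cast hp1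
    · exact le_rfl
    · omega
    · simp
    · exact .inr ⟨⊤, isMinSix_iff.1 h2, by simp⟩
  · obtain ⟨h0, h1, h2, h3, h4, h5, h6, h7⟩ := hl
    constructor <;> simp only [Label.params]
    · omega
    · omega
    · omega
    · exact not_dvd_of_coprime h6
    · exact h4
    · exact fun _ => h5
    · omega
    · refine .inr ⟨_, isMinThree_iff.1 h7, fun σ => mem_alternatingGroup_of_eq h4 ?_⟩
      -- Equality 2k = p^e would make p even. The strict inequality excludes k ≡ -k, so only even
      -- permutations are compatible with k.
      refine lt_of_le_of_ne h5 fun h => h0 ?_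
      have : 2 ∣ p ^ (α - s - t) := ⟨k, h.symm⟩
      exact ((Nat.prime_dvd_prime_iff_eq Nat.prime_two hp.out).1
        (Nat.prime_two.dvd_of_dvd_pow this)).symm
  · obtain ⟨rfl, h1, h2, h3, h4, h5, h6, h7⟩ := hl
    have h8 : 2 * k < 2 ^ (α - s - t) := by
      rw [show α - s - t = (α - s - t - 1) + 1 by omega, pow_succ]
      omega
    constructor <;> simp only [Label.params]
    · omega
    · omega
    · omega
    · exact not_dvd_of_coprime h6
    · exact h4
    · exact fun _ => h8.le
    · omega
    · exact .inr ⟨_, isMinThree_iff.1 h7, fun σ => mem_alternatingGroup_of_eq h4 h8⟩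
  · obtain ⟨rfl, h1, h2, h3, h4, h5, h6, h7⟩ := hl
    have h8 : α - s - t = 1 := by omega
    constructor <;> simp only [Label.params]
    · omega
    · omega
    · omega
    · exact not_dvd_of_coprime h6
    · exact h4
    · rw [h8] at h5 ⊢
      simp at h5
      omega
    · omega
    · exact .inr ⟨⊤, isMinSix_iff.1 h7, by simp⟩
  · obtain ⟨h1, h2, h3, h4⟩ := hl
    constructor <;> simp only [Label.params]
    · omega
    · omega
    · omega
    · exact_mod_cast hp1
    · exact le_rfl
    · omega
    · simp
    · exact .inr ⟨⊤, isMinSix_iff.1 h4, by simp⟩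

theorem IsCanonical.eq_of_famEquiv {q q' : ℕ × ℕ × ℕ × ℕ} (h : IsCanonical p α q)
    (h' : IsCanonical p α q')
    (he : FamEquiv (normalForm p α q.1 q.2.1 q.2.2.1 q.2.2.2)
      (normalForm p α q'.1 q'.2.1 q'.2.2.1 q'.2.2.2)) : q = q' := by
  obtain ⟨hs, ht, σ, hr, hk⟩ :=
    he.normalForm_invariants h.le h.le' h'.le h'.le' h.not_dvd h'.not_dvd
  obtain ⟨s, t, k, m⟩ := q
  obtain ⟨s', t', k', m'⟩ := q'
  simp only at hs ht hr hk he
  subst hs ht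
  have hkk : k = k' := by
    rcases lt_or_ge (s + t) α with hlt | hge
    · exact eq_of_intCast_eq_sign_mul h.pos h'.pos (h.two_mul_le hlt) (h'.two_mul_le hlt) hk
    · exact (h.eq_one hge).trans (h'.eq_one hge).symm
  subst hkk
  have key : ∀ {a b : ℕ} {τ : Equiv.Perm (Fin 3)} {H}, a = 0 → IsMinOrbit H (p ^ (t - s)) b →
      RatioRel τ ((a : ℤ) : ZMod (p ^ (t - s))) (b : ℤ) → False := by
    rintro a b τ H rfl hb hr
    obtain ⟨h0, h1⟩ := natCast_ne_zero_and_ne_one hb.1 hb.2.1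
    have : Nontrivial (ZMod (p ^ (t - s))) := ⟨⟨_, _, h0⟩⟩
    rw [Nat.cast_zero, Int.cast_zero, Int.cast_natCast] at hr
    rcases hr.eq_zero_or_one with h | h
    exacts [h0 h, h1 h]
  have hmm : m = m' := by
    rcases h.min with ⟨h0, -⟩ | ⟨H, hH, hσ⟩ <;> rcases h'.min with ⟨h0', -⟩ | ⟨H', hH', hσ'⟩
    · exact h0.trans h0'.symm
    · exact (key h0 hH' hr).elim
    · exact (key h0' hH hr.symm).elim
    · exact hH.eq hH' (hσ σ hk) (hσ' σ hk) (by simpa using hr)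
  rw [hmm]

/-- For t < α the third point has nonzero first coordinate. For t = α all three points lie on one
axis and are distinct exactly when 0, 1, m are distinct modulo p^(α-s). -/
theorem injective_normalForm_iff {s t : ℕ} {k m : ℤ} (ht : t ≤ α)
    (hs : s < α) (hk : ¬ (p : ℤ) ∣ k) :
    Function.Injective (normalForm p α s t k m) ↔
      (t = α → (m : ZMod (p ^ (t - s))) ≠ 0 ∧ (m : ZMod (p ^ (t - s))) ≠ 1) := by
  have hpp : Prime (p : ℤ) := Nat.prime_iff_prime_int.1 hp.out
  have hps : (p : ZMod (p ^ α)) ^ s ≠ 0 := by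
    intro h
    have := (pow_mul_intCast_eq_zero_iff (p := p) (α := α) (i := s) (x := 1)).1 (by simpa using h)
    exact hpp.not_dvd_one ((dvd_pow_self _ (by omega)).trans this)
  have hkt : (k : ZMod (p ^ α)) * p ^ t = 0 ↔ t = α := by
    rw [mul_comm, pow_mul_intCast_eq_zero_iff]
    constructor
    · intro h
      by_contra hne
      exact hk ((dvd_pow_self _ (by omega)).trans h)
    · rintro rfl
      simp
  have hm0 : (p : ZMod (p ^ α)) ^ s * m = 0 ↔ (m : ZMod (p ^ (α - s))) = 0 := by
    rw [pow_mul_intCast_eq_zero_iff, ZMod.intCast_zmod_eq_zero_iff_dvd, Nat.cast_pow]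
  have hm1 : (p : ZMod (p ^ α)) ^ s = p ^ s * m ↔ (m : ZMod (p ^ (α - s))) = 1 := by
    have := intCast_eq_iff_pow_mul_eq (p := p) (α := α) (i := s) (x := m) (y := 1)
    rw [Int.cast_one, Int.cast_one, mul_one] at this
    rw [this, eq_comm]
  constructor
  · rintro h rfl
    constructor
    · intro h0
      have : normalForm p t s t k m 0 = normalForm p t s t k m 2 := by
        simp only [normalForm, Matrix.cons_val, Prod.mk.injEq]
        exact ⟨(hkt.2 rfl).symm, (hm0.2 h0).symm⟩
      exact absurd (h this) (by decide)
    · intro h0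
      have : normalForm p t s t k m 1 = normalForm p t s t k m 2 := by
        simp only [normalForm, Matrix.cons_val, Prod.mk.injEq]
        exact ⟨(hkt.2 rfl).symm, hm1.2 h0⟩
      exact absurd (h this) (by decide)
  · intro h
    have h01 : normalForm p α s t k m 0 ≠ normalForm p α s t k m 1 := by
      simp only [normalForm, Matrix.cons_val, ne_eq, Prod.mk.injEq, true_and]
      exact fun h => hps h.symm
    have h02 : normalForm p α s t k m 0 ≠ normalForm p α s t k m 2 := by
      simp only [normalForm, Matrix.cons_val, ne_eq, Prod.mk.injEq]
      rintro ⟨h1, h2⟩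
      obtain rfl := hkt.1 h1.symm
      exact (h rfl).1 (hm0.1 h2.symm)
    have h12 : normalForm p α s t k m 1 ≠ normalForm p α s t k m 2 := by
      simp only [normalForm, Matrix.cons_val, ne_eq, Prod.mk.injEq]
      rintro ⟨h1, h2⟩
      obtain rfl := hkt.1 h1.symm
      exact (h rfl).2 (hm1.1 h2)
    intro i j hij
    fin_cases i <;> fin_cases j <;> first | rfl | exact absurd hij ‹_› | exact absurd hij.symm ‹_›

theorem Label.injective_points {l : Label} (hl : l.Valid p α) :
    Function.Injective (l.points p α) := by
  have h := hl.isCanonical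
  refine (injective_normalForm_iff h.le' h.lt h.not_dvd).2 fun ht => ?_
  rcases h.min with ⟨-, h1⟩ | ⟨H, hH, -⟩
  · exact absurd ht h1.ne
  · have := natCast_ne_zero_and_ne_one hH.1 hH.2.1
    simpa using this

/-- Take the absolute value of the residue of least absolute value, and let ε record its sign. -/
theorem exists_half {e : ℕ} {k : ℤ} (he : e ≠ 0) (hk : ¬ (p : ℤ) ∣ k) :
    ∃ k' : ℕ, 1 ≤ k' ∧ 2 * k' ≤ p ^ e ∧ k'.Coprime p ∧
      ∃ ε : ℤˣ, (k : ZMod (p ^ e)) = ((ε : ℤ) * k' : ℤ) := by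
  set v := (k : ZMod (p ^ e)).valMinAbs with hv
  have hvk : (k : ZMod (p ^ e)) = (v : ℤ) := (ZMod.coe_valMinAbs _).symm
  have hpv : ¬ (p : ℤ) ∣ v := by
    intro h
    rw [eq_comm, ZMod.intCast_eq_intCast_iff_dvd_sub] at hvk
    have h1 : (p : ℤ) ∣ k - v := (dvd_pow_self (p : ℤ) he).trans (by exact_mod_cast hvk)
    exact hk ((dvd_sub_left h).1 h1)
  have hpv' : ¬ p ∣ v.natAbs := by rwa [← Int.natCast_dvd]
  refine ⟨v.natAbs, ?_, ?_, ?_, ?_⟩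
  · refine Nat.one_le_iff_ne_zero.2 fun h => hpv' (by rw [h]; exact dvd_zero p)
  · have := ZMod.natAbs_valMinAbs_le (k : ZMod (p ^ e))
    rw [← hv] at this
    omega
  · exact ((Nat.Prime.coprime_iff_not_dvd hp.out).2 hpv').symm
  · rcases Int.natAbs_eq v with h | h
    · exact ⟨1, by rw [hvk, Units.val_one, one_mul, ← h]⟩
    · exact ⟨-1, by rw [hvk, Units.val_neg, Units.val_one, neg_one_mul, ← h]⟩

theorem exists_label_of_degenerate {s t : ℕ} {k m : ℤ} (hst : s ≤ t) (ht : t < α)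
    (hk : ¬ (p : ℤ) ∣ k)
    (hm : (m : ZMod (p ^ (t - s))) = 0 ∨ (m : ZMod (p ^ (t - s))) = 1) :
    ∃ l : Label, l.Valid p α ∧ FamEquiv (normalForm p α s t k m) (l.points p α) := by
  have hp1 : ¬ (p : ℤ) ∣ (1 : ℕ) := by
    exact_mod_cast (Nat.prime_iff_prime_int.1 hp.out).not_dvd_one
  obtain ⟨τ, hτ⟩ : ∃ τ, RatioRel τ (m : ZMod (p ^ (t - s))) 0 := by
    rcases hm with h | h
    · exact ⟨1, ratioRel_one.2 h.symm⟩
    · exact ⟨Equiv.swap 0 1, ratioRel_swap_zero_one.2 (by rw [h]; ring)⟩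
  rcases lt_or_ge (s + t) α with hlt | hge
  · obtain ⟨k', h1, h2, h3, ε, h4⟩ := exists_half (p := p) (e := α - s - t) (by omega) hk
    obtain ⟨σ, hσ, hr⟩ : ∃ σ, Equiv.Perm.sign σ = ε ∧
        RatioRel σ (m : ZMod (p ^ (t - s))) 0 := by
      by_cases hτε : Equiv.Perm.sign τ = ε
      · exact ⟨τ, hτε, hτ⟩
      -- The transposition acting by x ↦ x/(x-1) fixes 0, so the sign can be corrected at no cost.
      -- Hence family 2 has no coupling between k and m.
      · refine ⟨τ * Equiv.swap 0 2, ?_, hτ.trans (ratioRel_swap_zero_two.2 (by ring))⟩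
        rw [map_mul, Equiv.Perm.sign_swap (by decide)]
        rcases Int.units_eq_one_or (Equiv.Perm.sign τ) with h | h <;>
        rcases Int.units_eq_one_or ε with h' | h' <;> simp_all
    refine ⟨.fam2 k' s t, ⟨hst, ht, hlt, h1, h2, h3⟩, ?_⟩
    exact famEquiv_normalForm_of_ratioRel (σ := σ) hst ht.le hk (not_dvd_of_coprime h3)
      (by rw [hσ]; exact h4) (by simpa [Label.params] using hr)
  · refine ⟨.fam1 s t, ⟨by omega, hst, ht, hge⟩, ?_⟩
    exact famEquiv_normalForm_of_ratioRel (σ := τ) hst ht.le hk hp1 (intCast_eq_of_add_ge hge _ _)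
      (by simpa [Label.params] using hτ)

theorem exists_label_of_nondegenerate {s t : ℕ} {k m : ℤ} (hs : s < α) (hst : s ≤ t) (ht : t ≤ α)
    (hk : ¬ (p : ℤ) ∣ k)
    (hm : (m : ZMod (p ^ (t - s))) ≠ 0 ∧ (m : ZMod (p ^ (t - s))) ≠ 1) :
    ∃ l : Label, l.Valid p α ∧ FamEquiv (normalForm p α s t k m) (l.points p α) := by
  have hp1 : ¬ (p : ℤ) ∣ (1 : ℕ) := by
    exact_mod_cast (Nat.prime_iff_prime_int.1 hp.out).not_dvd_one
  have hst' : s < t := by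
    refine lt_of_le_of_ne hst ?_
    rintro rfl
    rw [Nat.sub_self, pow_zero] at hm
    exact hm.1 (Subsingleton.elim _ _)
  obtain ⟨m', hm', σ, -, hr⟩ := exists_isMinOrbit ⊤ hm
  rw [← isMinSix_iff] at hm'
  rcases lt_or_ge (s + t) α with hlt | hge
  -- Here k matters only modulo 2, where k = -k = 1, so all of S₃ acts on m.
  · by_cases hp2 : p = 2 ∧ s + t + 1 = α
    · obtain ⟨rfl, hα⟩ := hp2
      refine ⟨.fam42 1 s t m',
        ⟨rfl, hst', by omega, hα, le_rfl, Nat.one_le_two_pow, by simp, hm'⟩, ?_⟩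
      refine famEquiv_normalForm_of_ratioRel (σ := σ) hst ht hk hp1 ?_
        (by simpa [Label.params] using hr)
      rw [ZMod.intCast_eq_intCast_iff_dvd_sub, show α - s - t = 1 by omega]
      rcases Int.units_eq_one_or (Equiv.Perm.sign σ) with h | h <;>
        simp only [h, Label.params] <;> push_cast at * <;> omega
    · obtain ⟨k', h1, h2, h3, ε, h4⟩ := exists_half (p := p) (e := α - s - t) (by omega) hk
      obtain ⟨n, hn, τ, hτ, hr'⟩ : ∃ n, IsMinThree (p ^ (t - s)) n ∧
          ∃ τ, Equiv.Perm.sign τ = ε ∧ RatioRel τ (m : ZMod (p ^ (t - s))) n := by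
        rcases Int.units_eq_one_or ε with rfl | rfl
        · obtain ⟨n, hn, τ, hτ, h⟩ := exists_isMinOrbit (alternatingGroup (Fin 3)) hm
          exact ⟨n, isMinThree_iff.2 hn, τ, Equiv.Perm.mem_alternatingGroup.1 hτ, h⟩
        -- If k was reduced with sign -1, one odd move m ↦ 1 - m absorbs it before minimising under
        -- A₃.
        · have h5 : RatioRel (Equiv.swap 0 1) (m : ZMod (p ^ (t - s))) (1 - m) :=
            ratioRel_swap_zero_one.2 rfl
          obtain ⟨n, hn, τ, hτ, h⟩ := exists_isMinOrbit (alternatingGroup (Fin 3))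
            (h5.ne_zero_and_ne_one hm)
          refine ⟨n, isMinThree_iff.2 hn, Equiv.swap 0 1 * τ, ?_, h5.trans h⟩
          rw [map_mul, Equiv.Perm.mem_alternatingGroup.1 hτ, Equiv.Perm.sign_swap (by decide),
            mul_one]
      have key : FamEquiv (normalForm p α s t k m) (normalForm p α s t k' n) :=
        famEquiv_normalForm_of_ratioRel (σ := τ) hst ht hk (not_dvd_of_coprime h3)
          (by rw [hτ]; exact h4) (by simpa using hr')
      by_cases hp2' : p = 2
      · subst hp2'
        refine ⟨.fam41 k' s t n, ⟨rfl, hst', by omega, by omega, h1, ?_, h3, hn⟩, key⟩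
        have hα : s + t + 1 ≠ α := fun h => hp2 ⟨rfl, h⟩
        rw [show α - s - t = (α - s - t - 2) + 1 + 1 by omega, pow_succ] at h2
        rw [show α - s - t - 1 = (α - s - t - 2) + 1 by omega]
        -- The endpoint is a positive power of 2, hence not prime to p = 2.
        refine lt_of_le_of_ne (by omega) ?_
        rintro rfl
        exact not_dvd_of_coprime h3 (by push_cast; exact dvd_pow_self _ (by omega))
      · exact ⟨.fam4 k' s t n, ⟨hp2', hst', by omega, hlt, h1, h2, h3, hn⟩, key⟩
  · have key : FamEquiv (normalForm p α s t k m) (normalForm p α s t (1 : ℕ) m') :=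
      famEquiv_normalForm_of_ratioRel (σ := σ) hst ht hk hp1 (intCast_eq_of_add_ge hge _ _)
        (by simpa using hr)
    rcases ht.eq_or_lt with rfl | ht'
    · exact ⟨.fam3 s m', ⟨hs, hm'⟩, key⟩
    · exact ⟨.fam5 s t m', ⟨hst', ht', hge, hm'⟩, key⟩

theorem exists_label {a : Fin 3 → ZMod (p ^ α) × ZMod (p ^ α)} (ha : Function.Injective a) :
    ∃ l : Label, l.Valid p α ∧ FamEquiv a (l.points p α) := by
  obtain ⟨s, t, k, m, hs, hst, ht, hk, h⟩ := exists_famEquiv_normalForm ha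
  have hinj := (injective_normalForm_iff ht hs hk).1 (h.injective ha)
  suffices ∃ l : Label, l.Valid p α ∧ FamEquiv (normalForm p α s t k m) (l.points p α) by
    obtain ⟨l, hl, h'⟩ := this
    exact ⟨l, hl, h.trans h'⟩
  by_cases hm : (m : ZMod (p ^ (t - s))) ≠ 0 ∧ (m : ZMod (p ^ (t - s))) ≠ 1
  · exact exists_label_of_nondegenerate hs hst ht hk hm
  · exact exists_label_of_degenerate hst (lt_of_le_of_ne ht fun h => hm (hinj h)) hk (by tauto)

theorem Label.isTriple_rep {l : Label} (hl : l.Valid p α) : IsTriple (p ^ α) (l.rep p (p ^ α)) :=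
  isTriple_iff.2 ⟨_, Label.injective_points hl, Label.rep_eq hl⟩

theorem exists_label_uEquiv {T : Set (Matrix (ZMod (p ^ α)) (ZMod (p ^ α)) ℂ)}
    (hT : IsTriple (p ^ α) T) : ∃ l : Label, l.Valid p α ∧ UEquiv T (l.rep p (p ^ α)) := by
  obtain ⟨a, ha, rfl⟩ := isTriple_iff.1 hT
  obtain ⟨l, hl, h⟩ := exists_label ha
  refine ⟨l, hl, ?_⟩
  rw [Label.rep_eq hl]
  exact (uEquiv_range_iff ha (Label.injective_points hl)).2 h

theorem Label.eq_of_uEquiv {l l' : Label} (hl : l.Valid p α) (hl' : l'.Valid p α)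
    (h : UEquiv (l.rep p (p ^ α)) (l'.rep p (p ^ α))) : l = l' := by
  rw [Label.rep_eq hl, Label.rep_eq hl',
    uEquiv_range_iff (Label.injective_points hl) (Label.injective_points hl')] at h
  exact Label.eq_of_params_eq hl hl' (hl.isCanonical.eq_of_famEquiv hl'.isCanonical h)

theorem numClasses_eq : numClasses (p ^ α) = Nat.card {l : Label // l.Valid p α} := by
  refine (Nat.card_congr (Equiv.ofBijective
    (fun l : {l : Label // l.Valid p α} => (Quotient.mk (tripleSetoid (p ^ α))
      ⟨l.1.rep p (p ^ α), Label.isTriple_rep l.2⟩)) ⟨?_, ?_⟩)).symm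
  · intro l l' h
    exact Subtype.ext (Label.eq_of_uEquiv l.2 l'.2 (Quotient.exact h))
  · intro q
    induction q using Quotient.inductionOn with
    | h T =>
      obtain ⟨l, hl, h⟩ := exists_label_uEquiv T.2
      exact ⟨⟨l, hl⟩, Quotient.sound h.symm⟩

end Labels

/-! ### Counting orbits and half systems of units -/

section Counting

theorem RatioRel.right_unique {R : Type*} [CommRing R] {σ : Equiv.Perm (Fin 3)} {x y z : R}
    (h : RatioRel σ x y) (h' : RatioRel σ x z) : y = z := by
  have h1 := h.symm.trans h'
  rw [inv_mul_cancel] at h1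
  exact (ratioRel_one.1 h1).symm

/-- A polynomial whose zeros are `0`, `1` and the points fixed by a nontrivial permutation. -/
def fixPoly {R : Type*} [CommRing R] (x : R) : R :=
  x * (x - 1) * (2 * x - 1) * (x + 1) * (x - 2) * (x ^ 2 - x + 1)

theorem eq_one_of_ratioRel_self {R : Type*} [CommRing R] [Nontrivial R] {x : R}
    (hx : IsUnit (fixPoly x)) {σ : Equiv.Perm (Fin 3)} (h : RatioRel σ x x) : σ = 1 := by
  by_contra hσ
  have key : fixPoly x = 0 := by
    rw [fixPoly]
    rcases perm_fin_three σ with rfl | rfl | rfl | rfl | rfl | rfl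
    · exact absurd rfl hσ
    · linear_combination (x * (x - 1) * (x + 1) * (x - 2) * (x ^ 2 - x + 1)) *
        ratioRel_swap_zero_one.1 h
    · linear_combination (x * (2 * x - 1) * (x - 2) * (x ^ 2 - x + 1)) *
        ratioRel_swap_one_two.1 h
    · linear_combination ((x - 1) * (2 * x - 1) * (x + 1) * (x ^ 2 - x + 1)) *
        ratioRel_swap_zero_two.1 h
    · linear_combination (-(x * (x - 1) * (2 * x - 1) * (x + 1) * (x - 2))) * ratioRel_cycle.1 h
    · linear_combination (-(x * (x - 1) * (2 * x - 1) * (x + 1) * (x - 2))) * ratioRel_cycle'.1 h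
  rw [key] at hx
  exact not_isUnit_zero hx

theorem exists_ratioRel {R : Type*} [CommRing R] {x : R} (hx : IsUnit x) (hx' : IsUnit (x - 1))
    (σ : Equiv.Perm (Fin 3)) : ∃ y, RatioRel σ x y := by
  have hu : ∀ i, IsUnit (ratios x i) := fun i => by
    fin_cases i
    exacts [hx', hx.neg, isUnit_one]
  obtain ⟨v, hv⟩ := (hu (σ 2)).exists_right_inv
  refine ⟨-v * ratios x (σ 1), ?_⟩
  rw [RatioRel]
  linear_combination (-ratios x (σ 1)) * hv

open Classical in
/-- The minimal representatives of the orbits of `H` in `{2, …, n-1}`. -/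
def minSet (H : Subgroup (Equiv.Perm (Fin 3))) (n : ℕ) : Finset ℕ :=
  (Finset.range n).filter (IsMinOrbit H n)

theorem mem_minSet {H : Subgroup (Equiv.Perm (Fin 3))} {n m : ℕ} :
    m ∈ minSet H n ↔ IsMinOrbit H n m := by
  simp only [minSet, Finset.mem_filter, Finset.mem_range, and_iff_right_iff_imp]
  exact fun h => h.2.1

theorem card_minSet_le (H : Subgroup (Equiv.Perm (Fin 3))) (n : ℕ) : (minSet H n).card ≤ n := by
  classical
  exact (Finset.card_filter_le _ _).trans (Finset.card_range n).le

/-- Every residue other than 0 and 1 is the image of a minimal representative under some element of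
H. -/
theorem le_card_mul_card_minSet (H : Subgroup (Equiv.Perm (Fin 3))) (n : ℕ) [NeZero n] :
    n ≤ Nat.card H * (minSet H n).card + 2 := by
  classical
  let A : Finset (ZMod n) := Finset.univ \ {0, 1}
  have hA : n ≤ A.card + 2 := by
    have h1 : (Finset.univ : Finset (ZMod n)).card ≤ A.card + ({0, 1} : Finset (ZMod n)).card :=
      Finset.card_le_card_sdiff_add_card
    rw [Finset.card_univ, ZMod.card] at h1
    exact h1.trans (Nat.add_le_add_left Finset.card_le_two _)
  have hex : ∀ x : A, ∃ q : H × minSet H n, RatioRel q.1.1 ((q.2 : ℕ) : ZMod n) x.1 := by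
    intro x
    have hx : x.1 ≠ 0 ∧ x.1 ≠ 1 := by
      have := x.2
      simp only [A, Finset.mem_sdiff, Finset.mem_univ, true_and, Finset.mem_insert,
        Finset.mem_singleton, not_or] at this
      exact this
    obtain ⟨m, hm, σ, hσ, h⟩ := exists_isMinOrbit H hx
    exact ⟨⟨⟨σ⁻¹, inv_mem hσ⟩, ⟨m, mem_minSet.2 hm⟩⟩, h.symm⟩
  choose f hf using hex
  have hinj : Function.Injective f := fun x y hxy => by
    have h1 := hf x
    rw [hxy] at h1
    exact Subtype.ext (h1.right_unique (hf y))
  have h1 := Nat.card_le_card_of_injective f hinj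
  rw [Nat.card_prod, Nat.card_eq_fintype_card (α := A), Fintype.card_coe,
    Nat.card_eq_fintype_card (α := minSet H n), Fintype.card_coe] at h1
  omega

/-- The integers `k` prime to `p` with `1 ≤ k ≤ p^e / 2`. -/
def halfSet (p e : ℕ) : Finset ℕ := (Finset.Icc 1 (p ^ e / 2)).filter fun k => k.Coprime p

theorem mem_halfSet {p e k : ℕ} : k ∈ halfSet p e ↔ 1 ≤ k ∧ 2 * k ≤ p ^ e ∧ k.Coprime p := by
  rw [halfSet, Finset.mem_filter, Finset.mem_Icc, Nat.le_div_iff_mul_le two_pos, mul_comm 2,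
    and_assoc]

theorem two_mul_card_halfSet_le (p e : ℕ) : 2 * (halfSet p e).card ≤ p ^ e := by
  have h := Finset.card_filter_le (Finset.Icc 1 (p ^ e / 2)) fun k => k.Coprime p
  rw [Nat.card_Icc] at h
  have : (halfSet p e).card ≤ p ^ e / 2 + 1 - 1 := h
  omega

section PrimePower

variable {p : ℕ} [hp : Fact p.Prime]

theorem card_filter_fixPoly_le :
    (Finset.univ.filter fun r : ZMod p => fixPoly r = 0).card ≤ 7 := by
  classical
  open Polynomial in
  let P : (ZMod p)[X] := X * (X - 1) * (2 * X - 1) * (X + 1) * (X - 2) * (X ^ 2 - X + 1)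
  have hP : P ≠ 0 := by
    have h0 : ∀ Q : Polynomial (ZMod p), Q.coeff 0 ≠ 0 → Q ≠ 0 := fun Q hQ h => hQ (by simp [h])
    refine mul_ne_zero (mul_ne_zero (mul_ne_zero (mul_ne_zero (mul_ne_zero ?_ ?_) ?_) ?_) ?_) ?_
    · exact Polynomial.X_ne_zero
    · exact h0 _ (by simp)
    · exact h0 _ (by simp)
    · exact h0 _ (by simp)
    -- The constant term of this factor vanishes for p = 2, so here the leading coefficient is used.
    · exact Polynomial.X_sub_C_ne_zero (2 : ZMod p)
    · exact h0 _ (by simp)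
  have hdeg : P.natDegree ≤ 7 := by
    simp only [P]
    compute_degree
  have hsub : (Finset.univ.filter fun r : ZMod p => fixPoly r = 0) ⊆ P.roots.toFinset := by
    intro r hr
    rw [Finset.mem_filter] at hr
    rw [Multiset.mem_toFinset, Polynomial.mem_roots hP, Polynomial.IsRoot, ← hr.2]
    simp [P, fixPoly]
  exact (Finset.card_le_card hsub).trans ((Multiset.toFinset_card_le _).trans
    ((Polynomial.card_roots' P).trans hdeg))

/-- A number is determined by its residue modulo p, for which there are at most 7 choices, and its
quotient by p. -/
theorem card_filter_range_fixPoly_le (j : ℕ) :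
    ((Finset.range (p ^ (j + 1))).filter fun x : ℕ => fixPoly (x : ZMod p) = 0).card
      ≤ 7 * p ^ j := by
  classical
  have h1 : ((Finset.range (p ^ (j + 1))).filter fun x : ℕ => fixPoly (x : ZMod p) = 0).card ≤
      ((Finset.univ.filter fun r : ZMod p => fixPoly r = 0) ×ˢ Finset.range (p ^ j)).card := by
    refine Finset.card_le_card_of_injOn (fun x : ℕ => ((x : ZMod p), x / p)) ?_ ?_
    · intro x hx
      simp only [Finset.coe_filter, Finset.mem_range, Set.mem_ofPred_eq] at hx
      simp only [Finset.coe_product, Set.mem_prod, Finset.coe_filter, Finset.mem_univ, true_and,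
        Set.mem_ofPred_eq, Finset.coe_range, Set.mem_Iio]
      refine ⟨hx.2, Nat.div_lt_of_lt_mul ?_⟩
      rw [← pow_succ']
      exact hx.1
    · intro x _ y _ hxy
      simp only [Prod.mk.injEq] at hxy
      have h2 := (ZMod.natCast_eq_natCast_iff x y p).1 hxy.1
      rw [← Nat.mod_add_div x p, ← Nat.mod_add_div y p, hxy.2, show x % p = y % p from h2]
  rw [Finset.card_product, Finset.card_range] at h1
  exact h1.trans (Nat.mul_le_mul_right _ card_filter_fixPoly_le)

/-- Where `fixPoly` is nonzero modulo p, all six images exist and H acts freely; thus distinct pairs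
(σ, representative) have distinct images. The remaining representatives number at most 7 p^j. -/
theorem card_mul_card_minSet_le (H : Subgroup (Equiv.Perm (Fin 3))) (j : ℕ) :
    Nat.card H * (minSet H (p ^ (j + 1))).card ≤ p ^ (j + 1) + Nat.card H * (7 * p ^ j) := by
  classical
  set n := p ^ (j + 1) with hn
  have : Fact (1 < n) := ⟨Nat.one_lt_pow (by omega) hp.out.one_lt⟩
  let G : Finset ℕ := (minSet H n).filter fun x : ℕ => ¬ fixPoly (x : ZMod p) = 0
  have hG : (minSet H n).card ≤ G.card + 7 * p ^ j := by
    rw [← Finset.card_filter_add_card_filter_not (s := minSet H n)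
      (fun x : ℕ => fixPoly (x : ZMod p) = 0), add_comm]
    refine Nat.add_le_add_left
      (le_trans (Finset.card_le_card ?_) (card_filter_range_fixPoly_le j)) _
    exact Finset.filter_subset_filter _ (Finset.filter_subset _ _)
  have hunit : ∀ x : ℕ, ¬ fixPoly (x : ZMod p) = 0 → IsUnit (fixPoly (x : ZMod n)) := by
    intro x hx
    have e : ∀ q : ℕ, ((fixPoly (x : ℤ) : ℤ) : ZMod q) = fixPoly (x : ZMod q) := fun q => by
      simp [fixPoly]
    rw [← e] at hx ⊢
    refine isUnit_intCast_of_not_dvd fun h => hx ?_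
    rwa [ZMod.intCast_zmod_eq_zero_iff_dvd]
  have hex : ∀ q : H × G, ∃ y : ZMod n, RatioRel q.1.1 ((q.2 : ℕ) : ZMod n) y := by
    rintro ⟨σ, m, hm⟩
    have h1 := hunit m (Finset.mem_filter.1 hm).2
    simp only [fixPoly, IsUnit.mul_iff] at h1
    exact exists_ratioRel h1.1.1.1.1.1 h1.1.1.1.1.2 _
  choose f hf using hex
  have hinj : Function.Injective f := by
    rintro ⟨σ, m, hm⟩ ⟨τ, m', hm'⟩ h
    have h1 := hf ⟨σ, m, hm⟩
    have h2 := hf ⟨τ, m', hm'⟩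
    rw [← h] at h2
    have h3 := h1.trans h2.symm
    have hmm : m = m' := (mem_minSet.1 (Finset.mem_filter.1 hm).1).eq
      (mem_minSet.1 (Finset.mem_filter.1 hm').1) (mul_mem σ.2 (inv_mem τ.2))
      (mul_mem σ.2 (inv_mem τ.2)) h3
    subst hmm
    have h4 := eq_one_of_ratioRel_self (hunit m (Finset.mem_filter.1 hm).2) h3
    have h5 : σ = τ := Subtype.ext (mul_inv_eq_one.1 h4)
    rw [h5]
  have h1 := Nat.card_le_card_of_injective f hinj
  rw [Nat.card_prod, Nat.card_eq_fintype_card (α := G), Fintype.card_coe, Nat.card_zmod] at h1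
  calc Nat.card H * (minSet H n).card ≤ Nat.card H * (G.card + 7 * p ^ j) :=
        Nat.mul_le_mul_left _ hG
    _ ≤ _ := by rw [mul_add]; omega

/-- Division by p injects the discarded multiples of p into the integers from 1 to p^e/2. -/
theorem le_two_mul_card_halfSet (e : ℕ) :
    p ^ (e + 1) ≤ 2 * (halfSet p (e + 1)).card + 3 * p ^ e := by
  have h := Finset.card_filter_add_card_filter_not (s := Finset.Icc 1 (p ^ (e + 1) / 2))
    fun k => k.Coprime p
  rw [Nat.card_Icc] at h
  have h2 : ((Finset.Icc 1 (p ^ (e + 1) / 2)).filter fun k => ¬ k.Coprime p).card ≤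
      (Finset.Icc 1 (p ^ e / 2)).card := by
    refine Finset.card_le_card_of_injOn (fun k => k / p) ?_ ?_
    · intro k hk
      simp only [Finset.coe_filter, Finset.mem_Icc, Set.mem_ofPred_eq] at hk
      obtain ⟨c, rfl⟩ : p ∣ k := by
        by_contra h
        exact hk.2 ((Nat.Prime.coprime_iff_not_dvd hp.out).2 h).symm
      simp only [Finset.coe_Icc, Set.mem_Icc, Nat.mul_div_cancel_left _ hp.out.pos]
      refine ⟨Nat.pos_of_ne_zero (by rintro rfl; simp at hk), ?_⟩
      rw [Nat.le_div_iff_mul_le two_pos]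
      have h3 := (Nat.le_div_iff_mul_le two_pos).1 hk.1.2
      rw [pow_succ', mul_assoc] at h3
      exact Nat.le_of_mul_le_mul_left h3 hp.out.pos
    · intro k hk l hl hkl
      simp only [Finset.coe_filter, Finset.mem_Icc, Set.mem_ofPred_eq] at hk hl
      have hd : ∀ k : ℕ, ¬ k.Coprime p → p ∣ k := fun k hk => by
        by_contra h
        exact hk ((Nat.Prime.coprime_iff_not_dvd hp.out).2 h).symm
      rw [← Nat.div_mul_cancel (hd k hk.2), ← Nat.div_mul_cancel (hd l hl.2)]
      simp only at hkl
      rw [hkl]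
  rw [Nat.card_Icc] at h2
  have h3 : 1 ≤ p ^ e := Nat.one_le_pow _ _ hp.out.pos
  change (halfSet p (e + 1)).card + _ = _ at h
  omega

end PrimePower

end Counting

theorem sum_range_pow_sub_le {p : ℕ} (hp : 2 ≤ p) (n : ℕ) :
    ∑ s ∈ Finset.range n, p ^ (n - 1 - s) ≤ 2 * p ^ (n - 1) := by
  rw [Finset.sum_range_reflect (fun i => p ^ i) n]
  induction n with
  | zero => simp
  | succ n ih =>
    rw [Finset.sum_range_succ]
    rcases n with _ | n
    · simp
    · simp only [Nat.add_sub_cancel] at ih ⊢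
      have : 2 * p ^ n ≤ p ^ (n + 1) := by
        rw [pow_succ']
        exact Nat.mul_le_mul_right _ hp
      omega

open Classical in
-- The sum over t costs a factor α and the geometric sum over s a factor 2.
theorem card_biUnion_le_of_card_le {β : Type*} {p : ℕ} (hp : 2 ≤ p) {α c : ℕ}
    {I : Finset (ℕ × ℕ)} (hI : I ⊆ Finset.range α ×ˢ Finset.range α) {F : ℕ × ℕ → Finset β}
    (hF : ∀ q ∈ I, (F q).card ≤ c * p ^ (α - 1 - q.1)) :
    (I.biUnion F).card ≤ 2 * c * (α * p ^ (α - 1)) := by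
  calc (I.biUnion F).card ≤ ∑ q ∈ I, (F q).card := Finset.card_biUnion_le
    _ ≤ ∑ q ∈ I, c * p ^ (α - 1 - q.1) := Finset.sum_le_sum hF
    _ ≤ ∑ q ∈ Finset.range α ×ˢ Finset.range α, c * p ^ (α - 1 - q.1) :=
      Finset.sum_le_sum_of_subset hI
    _ = α * (c * ∑ s ∈ Finset.range α, p ^ (α - 1 - s)) := by
      rw [Finset.sum_product]
      simp [Finset.mul_sum]
    _ ≤ α * (c * (2 * p ^ (α - 1))) := by gcongr; exact sum_range_pow_sub_le hp α
    _ = _ := by ring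

/-! ### Main labels, error labels and the asymptotic count -/

section Families

/-- The labels of the second family with given exponents. -/
def labels2 (p α s t : ℕ) : Finset Label :=
  (halfSet p (α - s - t)).map ⟨fun k => .fam2 k s t, fun _ _ h => by cases h; rfl⟩

/-- The labels of the third family with given exponent. -/
def labels3 (p α s : ℕ) : Finset Label :=
  (minSet ⊤ (p ^ (α - s))).map ⟨fun m => .fam3 s m, fun _ _ h => by cases h; rfl⟩

/-- The labels of the fourth family with given exponents. -/
def labels4 (p α s t : ℕ) : Finset Label :=
  (halfSet p (α - s - t) ×ˢ minSet (alternatingGroup (Fin 3)) (p ^ (t - s))).map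
    ⟨fun q => .fam4 q.1 s t q.2, fun _ _ h => by
      simp only [Label.fam4.injEq] at h
      exact Prod.ext h.1 h.2.2.2⟩

open Classical in
/-- The labels that contribute to the leading term of the count. -/
def mainLabels (p α : ℕ) : Finset Label :=
  labels2 p α 0 0 ∪ labels3 p α 0 ∪ (Finset.Ioo 0 α).biUnion fun t => labels4 p α 0 t

theorem card_mainLabels (p α : ℕ) : (mainLabels p α).card =
    (halfSet p α).card + (minSet ⊤ (p ^ α)).card + ∑ t ∈ Finset.Ioo 0 α,
      (halfSet p (α - t)).card * (minSet (alternatingGroup (Fin 3)) (p ^ t)).card := by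
  classical
  rw [mainLabels, Finset.card_union_of_disjoint, Finset.card_union_of_disjoint,
    Finset.card_biUnion]
  · simp [labels2, labels3, labels4]
  · intro t _ t' _ hne
    rw [Function.onFun, Finset.disjoint_left]
    rintro l hl hl'
    simp only [labels4, Finset.mem_map] at hl hl'
    obtain ⟨q, -, rfl⟩ := hl
    obtain ⟨q', -, h⟩ := hl'
    have h' : Label.fam4 q'.1 0 t' q'.2 = Label.fam4 q.1 0 t q.2 := h
    simp only [Label.fam4.injEq] at h'
    exact hne h'.2.2.1.symm
  · rw [Finset.disjoint_left]
    rintro l hl hl'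
    simp only [labels2, labels3, Finset.mem_map] at hl hl'
    obtain ⟨q, -, rfl⟩ := hl
    obtain ⟨q', -, h⟩ := hl'
    cases h
  · rw [Finset.disjoint_left]
    rintro l hl hl'
    simp only [labels2, labels3, labels4, Finset.mem_map, Finset.mem_union,
      Finset.mem_biUnion] at hl hl'
    obtain ⟨t, -, q', -, rfl⟩ := hl'
    rcases hl with ⟨q, -, h⟩ | ⟨q, -, h⟩ <;> cases h

variable {p α : ℕ}

theorem mainLabels_valid (hp2 : p ≠ 2) (hα : 1 ≤ α) {l : Label} (hl : l ∈ mainLabels p α) :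
    l.Valid p α := by
  classical
  simp only [mainLabels, labels2, labels3, labels4, Finset.mem_map, Finset.mem_union,
    Finset.mem_biUnion, Finset.mem_product, mem_halfSet, mem_minSet,
    Finset.mem_Ioo] at hl
  rcases hl with (⟨k, ⟨h1, h2, h3⟩, rfl⟩ | ⟨m, hm, rfl⟩) | ⟨t, ht, q, ⟨⟨h1, h2, h3⟩, hm⟩, rfl⟩
  · exact ⟨le_rfl, by omega, by omega, h1, h2, h3⟩
  · exact ⟨by omega, isMinSix_iff.2 hm⟩
  · exact ⟨hp2, ht.1, ht.2, by omega, h1, h2, h3, isMinThree_iff.2 hm⟩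

theorem card_labels4_le (s t : ℕ) :
    (labels4 p α s t).card ≤ p ^ (α - s - t) * p ^ (t - s) := by
  rw [labels4, Finset.card_map, Finset.card_product]
  refine Nat.mul_le_mul ?_ (card_minSet_le _ _)
  have := two_mul_card_halfSet_le p (α - s - t)
  omega

variable [hp : Fact p.Prime]

theorem pow_le_one_mul_pow {i j : ℕ} (h : i ≤ j) : p ^ i ≤ 1 * p ^ j := by
  rw [one_mul]
  exact Nat.pow_le_pow_right hp.out.pos h

variable (p α) in
theorem exists_finset_fam1 :
    ∃ E : Finset Label, E.card ≤ 2 * 1 * (α * p ^ (α - 1)) ∧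
    ∀ s t, (Label.fam1 s t).Valid p α → Label.fam1 s t ∈ E := by
  classical
  refine ⟨(Finset.range α ×ˢ Finset.range α).biUnion fun q => {Label.fam1 q.1 q.2},
    card_biUnion_le_of_card_le hp.out.two_le subset_rfl fun q _ => ?_, ?_⟩
  · rw [Finset.card_singleton, one_mul]
    exact Nat.one_le_pow _ _ hp.out.pos
  · rintro s t ⟨-, hst, ht, -⟩
    simp only [Finset.mem_biUnion, Finset.mem_product, Finset.mem_range, Finset.mem_singleton]
    exact ⟨(s, t), ⟨by omega, ht⟩, rfl⟩

variable (p α) in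
theorem exists_finset_fam2 :
    ∃ E : Finset Label, E.card ≤ 2 * 1 * (α * p ^ (α - 1)) ∧
    ∀ k s t, (Label.fam2 k s t).Valid p α →
      Label.fam2 k s t ∈ mainLabels p α ∨ Label.fam2 k s t ∈ E := by
  classical
  refine ⟨((Finset.range α ×ˢ Finset.range α).filter fun q => q.1 + q.2 < α ∧ 1 ≤ q.2).biUnion
    fun q => labels2 p α q.1 q.2,
    card_biUnion_le_of_card_le hp.out.two_le (Finset.filter_subset _ _) fun q hq => ?_, ?_⟩
  · rw [Finset.mem_filter] at hq
    rw [labels2, Finset.card_map]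
    have := two_mul_card_halfSet_le p (α - q.1 - q.2)
    exact (by omega : (halfSet p (α - q.1 - q.2)).card ≤ p ^ (α - q.1 - q.2)).trans
      (pow_le_one_mul_pow (by omega))
  · rintro k s t ⟨hst, ht, hlt, hk⟩
    have hmem : Label.fam2 k s t ∈ labels2 p α s t :=
      Finset.mem_map.2 ⟨k, mem_halfSet.2 hk, rfl⟩
    rcases Nat.eq_zero_or_pos t with rfl | hpos
    · obtain rfl : s = 0 := by omega
      exact .inl (Finset.mem_union_left _ (Finset.mem_union_left _ hmem))
    · right
      simp only [Finset.mem_biUnion, Finset.mem_filter, Finset.mem_product, Finset.mem_range]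
      exact ⟨(s, t), ⟨⟨by omega, ht⟩, hlt, hpos⟩, hmem⟩

variable (p α) in
theorem exists_finset_fam3 :
    ∃ E : Finset Label, E.card ≤ 2 * 1 * (α * p ^ (α - 1)) ∧
    ∀ s m, (Label.fam3 s m).Valid p α →
      Label.fam3 s m ∈ mainLabels p α ∨ Label.fam3 s m ∈ E := by
  classical
  -- The index s ≥ 1 is shifted by one to fit the common bound; the second coordinate is a dummy.
  refine ⟨((Finset.range α ×ˢ Finset.range α).filter fun q => q.1 + 1 < α).biUnion
    fun q => labels3 p α (q.1 + 1),
    card_biUnion_le_of_card_le hp.out.two_le (Finset.filter_subset _ _) fun q hq => ?_, ?_⟩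
  · rw [labels3, Finset.card_map]
    exact (card_minSet_le _ _).trans (pow_le_one_mul_pow (by omega))
  · rintro s m ⟨hs, hm⟩
    have hmem : Label.fam3 s m ∈ labels3 p α s :=
      Finset.mem_map.2 ⟨m, mem_minSet.2 (isMinSix_iff.1 hm), rfl⟩
    rcases s with _ | s
    · exact .inl (Finset.mem_union_left _ (Finset.mem_union_right _ hmem))
    · right
      simp only [Finset.mem_biUnion, Finset.mem_filter, Finset.mem_product, Finset.mem_range]
      exact ⟨(s, 0), ⟨⟨by omega, by omega⟩, hs⟩, hmem⟩

-- For s ≥ 1 the pair (s, t) contributes at most p^(α-s-t) p^(t-s) = p^(α-2s) ≤ p^(α-1-s) labels.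
variable (p α) in
theorem exists_finset_fam4 :
    ∃ E : Finset Label, E.card ≤ 2 * 1 * (α * p ^ (α - 1)) ∧
    ∀ k s t m, (Label.fam4 k s t m).Valid p α →
      Label.fam4 k s t m ∈ mainLabels p α ∨ Label.fam4 k s t m ∈ E := by
  classical
  refine ⟨((Finset.range α ×ˢ Finset.range α).filter
    fun q => 1 ≤ q.1 ∧ q.1 < q.2 ∧ q.1 + q.2 < α).biUnion fun q => labels4 p α q.1 q.2,
    card_biUnion_le_of_card_le hp.out.two_le (Finset.filter_subset _ _) fun q hq => ?_, ?_⟩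
  · rw [Finset.mem_filter] at hq
    refine (card_labels4_le _ _).trans ?_
    rw [← pow_add]
    exact pow_le_one_mul_pow (by omega)
  · rintro k s t m ⟨-, hst, ht, hlt, hk1, hk2, hk3, hm⟩
    have hmem : Label.fam4 k s t m ∈ labels4 p α s t :=
      Finset.mem_map.2 ⟨(k, m), Finset.mem_product.2
        ⟨mem_halfSet.2 ⟨hk1, hk2, hk3⟩, mem_minSet.2 (isMinThree_iff.1 hm)⟩, rfl⟩
    rcases Nat.eq_zero_or_pos s with rfl | hpos
    · exact .inl (Finset.mem_union_right _
        (Finset.mem_biUnion.2 ⟨t, Finset.mem_Ioo.2 ⟨hst, ht⟩, hmem⟩))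
    · right
      simp only [Finset.mem_biUnion, Finset.mem_filter, Finset.mem_product, Finset.mem_range]
      exact ⟨(s, t), ⟨⟨by omega, ht⟩, hpos, hst, hlt⟩, hmem⟩

-- For p = 2 the terms with s = 0 may enter the error as well, since 2^α = 2 · 2^(α-1); this costs
-- the constant 2.
variable (p α) in
theorem exists_finset_of_two (f : ℕ → ℕ → ℕ → ℕ → Label) :
    ∃ E : Finset Label, E.card ≤ 2 * 2 * (α * p ^ (α - 1)) ∧
    ∀ k s t m, p = 2 → s < t → s + t < α → k < p ^ (α - s - t) → m < p ^ (t - s) →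
      f k s t m ∈ E := by
  classical
  refine ⟨((Finset.range α ×ˢ Finset.range α).filter
    fun q => p = 2 ∧ q.1 < q.2 ∧ q.1 + q.2 < α).biUnion fun q =>
      (Finset.range (p ^ (α - q.1 - q.2)) ×ˢ Finset.range (p ^ (q.2 - q.1))).image
        fun r => f r.1 q.1 q.2 r.2,
    card_biUnion_le_of_card_le hp.out.two_le (Finset.filter_subset _ _) fun q hq => ?_, ?_⟩
  · obtain ⟨-, rfl, hq⟩ := Finset.mem_filter.1 hq
    refine Finset.card_image_le.trans ?_
    rw [Finset.card_product, Finset.card_range, Finset.card_range, ← pow_add, ← pow_succ']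
    exact Nat.pow_le_pow_right two_pos (by omega)
  · rintro k s t m h2 hst hlt hk hm
    simp only [Finset.mem_biUnion, Finset.mem_filter, Finset.mem_product, Finset.mem_range,
      Finset.mem_image]
    exact ⟨(s, t), ⟨⟨by omega, by omega⟩, h2, hst, hlt⟩, (k, m), ⟨hk, hm⟩, rfl⟩

variable (p α) in
theorem exists_finset_fam5 :
    ∃ E : Finset Label, E.card ≤ 2 * 1 * (α * p ^ (α - 1)) ∧
    ∀ s t m, (Label.fam5 s t m).Valid p α → Label.fam5 s t m ∈ E := by
  classical
  refine ⟨((Finset.range α ×ˢ Finset.range α).filter fun q => 1 ≤ q.1 ∧ q.1 < q.2).biUnion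
    fun q => (Finset.range (p ^ (q.2 - q.1))).image fun m => Label.fam5 q.1 q.2 m,
    card_biUnion_le_of_card_le hp.out.two_le (Finset.filter_subset _ _) fun q hq => ?_, ?_⟩
  · simp only [Finset.mem_filter, Finset.mem_product, Finset.mem_range] at hq
    refine Finset.card_image_le.trans ?_
    rw [Finset.card_range]
    exact pow_le_one_mul_pow (by omega)
  · rintro s t m ⟨hst, ht, hlt, hm⟩
    simp only [Finset.mem_biUnion, Finset.mem_filter, Finset.mem_product, Finset.mem_range,
      Finset.mem_image]
    exact ⟨(s, t), ⟨⟨by omega, ht⟩, by omega, hst⟩, m, (isMinSix_iff.1 hm).2.1, rfl⟩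

/-- Five families contribute 2 each to the constant, and the two families special to p = 2
contribute 4 each. -/
theorem exists_card_le_of_valid : ∃ E : Finset Label, E.card ≤ 18 * (α * p ^ (α - 1)) ∧
    ∀ l : Label, l.Valid p α → l ∈ mainLabels p α ∨ l ∈ E := by
  classical
  obtain ⟨E1, c1, h1⟩ := exists_finset_fam1 p α
  obtain ⟨E2, c2, h2⟩ := exists_finset_fam2 p α
  obtain ⟨E3, c3, h3⟩ := exists_finset_fam3 p α
  obtain ⟨E4, c4, h4⟩ := exists_finset_fam4 p α
  obtain ⟨E41, c41, h41⟩ := exists_finset_of_two p α .fam41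
  obtain ⟨E42, c42, h42⟩ := exists_finset_of_two p α .fam42
  obtain ⟨E5, c5, h5⟩ := exists_finset_fam5 p α
  refine ⟨E1 ∪ E2 ∪ E3 ∪ E4 ∪ E41 ∪ E42 ∪ E5, ?_, ?_⟩
  · have d1 := Finset.card_union_le E1 E2
    have d2 := Finset.card_union_le (E1 ∪ E2) E3
    have d3 := Finset.card_union_le (E1 ∪ E2 ∪ E3) E4
    have d4 := Finset.card_union_le (E1 ∪ E2 ∪ E3 ∪ E4) E41
    have d5 := Finset.card_union_le (E1 ∪ E2 ∪ E3 ∪ E4 ∪ E41) E42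
    have d6 := Finset.card_union_le (E1 ∪ E2 ∪ E3 ∪ E4 ∪ E41 ∪ E42) E5
    omega
  · intro l hl
    simp only [Finset.mem_union]
    rcases l with ⟨s, t⟩ | ⟨k, s, t⟩ | ⟨s, m⟩ | ⟨k, s, t, m⟩ | ⟨k, s, t, m⟩ | ⟨k, s, t, m⟩ |
      ⟨s, t, m⟩
    · have := h1 s t hl
      tauto
    · have := h2 k s t hl
      tauto
    · have := h3 s m hl
      tauto
    · have := h4 k s t m hl
      tauto
    · obtain ⟨rfl, hst, ht, hlt, -, hk, -, hm⟩ := hl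
      have := h41 k s t m rfl hst (by omega)
        (hk.trans_le (Nat.pow_le_pow_right two_pos (by omega))) (isMinThree_iff.1 hm).2.1
      tauto
    · obtain ⟨rfl, hst, ht, hlt, -, hk, -, hm⟩ := hl
      have := h42 k s t m rfl hst (by omega)
        (hk.trans_lt (Nat.pow_lt_pow_right one_lt_two (by omega))) (isMinSix_iff.1 hm).2.1
      tauto
    · have := h5 s t m hl
      tauto

theorem abs_card_mainLabels_sub_le (hα : 1 ≤ α) :
    |((mainLabels p α).card : ℝ) - ((α : ℝ) + 3) / 6 * (p : ℝ) ^ α| ≤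
      20 * ((α : ℝ) * (p : ℝ) ^ (α - 1)) := by
  have hhalf : ∀ e, 1 ≤ e → |((halfSet p e).card : ℝ) - (p : ℝ) ^ e / 2|
      ≤ 3 / 2 * (p : ℝ) ^ (e - 1) := by
    intro e he
    obtain ⟨e, rfl⟩ := Nat.exists_eq_add_of_le' he
    have h1 := two_mul_card_halfSet_le p (e + 1)
    have h2 := le_two_mul_card_halfSet (p := p) e
    rify at h1 h2
    rw [abs_le, Nat.add_sub_cancel]
    have : (0 : ℝ) ≤ (p : ℝ) ^ e := by positivity
    constructor <;> linarith
  have hmin : ∀ H : Subgroup (Equiv.Perm (Fin 3)), ∀ j, 1 ≤ j →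
      |((minSet H (p ^ j)).card : ℝ) - (p : ℝ) ^ j / (Nat.card H : ℝ)|
        ≤ 7 * (p : ℝ) ^ (j - 1) := by
    intro H j hj
    obtain ⟨j, rfl⟩ := Nat.exists_eq_add_of_le' hj
    have h1 := le_card_mul_card_minSet H (p ^ (j + 1))
    have h2 := card_mul_card_minSet_le (p := p) H j
    have h3 : 1 ≤ p ^ j := Nat.one_le_pow _ _ hp.out.pos
    have h4 : 1 ≤ Nat.card H := Nat.card_pos
    rify at h1 h2 h3 h4
    have hq : (0 : ℝ) < Nat.card H := by linarith
    rw [Nat.add_sub_cancel]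
    have h5 : ((minSet H (p ^ (j + 1))).card : ℝ) - (p : ℝ) ^ (j + 1) / (Nat.card H : ℝ)
        = ((Nat.card H : ℝ) * (minSet H (p ^ (j + 1))).card - (p : ℝ) ^ (j + 1)) / Nat.card H := by
      field_simp
    rw [h5, abs_div, abs_of_pos hq, div_le_iff₀ hq, abs_le]
    constructor <;> nlinarith
  have hc6 : Nat.card (⊤ : Subgroup (Equiv.Perm (Fin 3))) = 6 := by
    rw [Subgroup.card_top, Nat.card_eq_fintype_card, Fintype.card_perm]
    decide
  have hc3 : Nat.card (alternatingGroup (Fin 3)) = 3 := by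
    rw [Nat.card_eq_fintype_card]
    decide
  have hP : (1 : ℝ) ≤ p := by exact_mod_cast hp.out.pos
  have hprod : ∀ t ∈ Finset.Ioo 0 α, |((halfSet p (α - t)).card : ℝ) *
      (minSet (alternatingGroup (Fin 3)) (p ^ t)).card - (p : ℝ) ^ α / 6|
        ≤ 5 * (p : ℝ) ^ (α - 1) := by
    intro t ht
    rw [Finset.mem_Ioo] at ht
    have h1 := hhalf (α - t) (by omega)
    have h2 := hmin (alternatingGroup (Fin 3)) t ht.1
    have h3 : ((minSet (alternatingGroup (Fin 3)) (p ^ t)).card : ℝ) ≤ (p : ℝ) ^ t := by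
      exact_mod_cast card_minSet_le _ _
    rw [hc3] at h2
    have e1 : (p : ℝ) ^ α = (p : ℝ) ^ (α - t) * (p : ℝ) ^ t := by
      rw [← pow_add]; congr 1; omega
    have e2 : (p : ℝ) ^ (α - 1) = (p : ℝ) ^ (α - t - 1) * (p : ℝ) ^ t := by
      rw [← pow_add]; congr 1; omega
    have e3 : (p : ℝ) ^ (α - 1) = (p : ℝ) ^ (α - t) * (p : ℝ) ^ (t - 1) := by
      rw [← pow_add]; congr 1; omega
    set a : ℝ := ((halfSet p (α - t)).card : ℝ)
    set b : ℝ := ((minSet (alternatingGroup (Fin 3)) (p ^ t)).card : ℝ)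
    have hb : 0 ≤ b := Nat.cast_nonneg _
    -- The product error is split one factor at a time; the parts contribute 3/2 and 7/2, whence the
    -- constant 5.
    have key : a * b - (p : ℝ) ^ α / 6 = (a - (p : ℝ) ^ (α - t) / 2) * b
        + (p : ℝ) ^ (α - t) / 2 * (b - (p : ℝ) ^ t / (3 : ℕ)) := by
      rw [e1]; push_cast; ring
    rw [key]
    refine (abs_add_le _ _).trans ?_
    rw [abs_mul, abs_mul, abs_of_nonneg hb,
      abs_of_nonneg (show (0 : ℝ) ≤ (p : ℝ) ^ (α - t) / 2 by positivity)]
    have t1 := mul_le_mul h1 h3 hb (by positivity)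
    have t2 := mul_le_mul_of_nonneg_left h2 (show (0 : ℝ) ≤ (p : ℝ) ^ (α - t) / 2 by positivity)
    have t3 : 3 / 2 * (p : ℝ) ^ (α - t - 1) * (p : ℝ) ^ t = 3 / 2 * (p : ℝ) ^ (α - 1) := by
      rw [e2]; ring
    have t4 : (p : ℝ) ^ (α - t) / 2 * (7 * (p : ℝ) ^ (t - 1)) = 7 / 2 * (p : ℝ) ^ (α - 1) := by
      rw [e3]; ring
    linarith
  have hsum : |∑ t ∈ Finset.Ioo 0 α, (((halfSet p (α - t)).card : ℝ) *
      (minSet (alternatingGroup (Fin 3)) (p ^ t)).card - (p : ℝ) ^ α / 6)|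
        ≤ (α - 1) * (5 * (p : ℝ) ^ (α - 1)) := by
    refine (Finset.abs_sum_le_sum_abs _ _).trans ((Finset.sum_le_sum hprod).trans ?_)
    rw [Finset.sum_const, Nat.card_Ioo, nsmul_eq_mul, Nat.sub_zero, Nat.cast_sub hα]
    simp
  have h1 := hhalf α hα
  have h2 := hmin ⊤ α hα
  rw [hc6] at h2
  have hαr : (1 : ℝ) ≤ α := by exact_mod_cast hα
  have hQ : (0 : ℝ) ≤ (p : ℝ) ^ (α - 1) := by positivity
  rw [Finset.sum_sub_distrib, Finset.sum_const, Nat.card_Ioo, nsmul_eq_mul, Nat.sub_zero,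
    Nat.cast_sub hα] at hsum
  rw [card_mainLabels]
  push_cast at *
  have hm : (p : ℝ) ^ (α - 1) ≤ α * (p : ℝ) ^ (α - 1) := le_mul_of_one_le_left hQ hαr
  rw [abs_le] at *
  constructor <;> nlinarith

theorem abs_numClasses_sub_le (hα : 1 ≤ α) :
    |(numClasses (p ^ α) : ℝ) - ((α : ℝ) + 3) / 6 * (p : ℝ) ^ α| ≤
      40 * ((α : ℝ) * (p : ℝ) ^ (α - 1)) := by
  classical
  obtain ⟨E, hE, hmem⟩ := exists_card_le_of_valid (p := p) (α := α)
  have hmain := abs_card_mainLabels_sub_le (p := p) hα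
  have hsub : {l : Label | l.Valid p α} ⊆ ↑(mainLabels p α ∪ E) := fun l hl => by
    rw [Finset.coe_union]
    exact hmem l hl
  have hN : numClasses (p ^ α) = {l : Label | l.Valid p α}.ncard := numClasses_eq
  have hfin : {l : Label | l.Valid p α}.Finite := (Finset.finite_toSet _).subset hsub
  have hup : numClasses (p ^ α) ≤ (mainLabels p α).card + 18 * (α * p ^ (α - 1)) := by
    rw [hN]
    refine (Set.ncard_le_ncard hsub (Finset.finite_toSet _)).trans ?_
    rw [Set.ncard_coe_finset]
    exact (Finset.card_union_le _ _).trans (Nat.add_le_add_left hE _)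
  have hαr : (1 : ℝ) ≤ α := by exact_mod_cast hα
  have hQ : (0 : ℝ) ≤ (α : ℝ) * (p : ℝ) ^ (α - 1) := by positivity
  rify at hup
  rw [abs_le] at hmain ⊢
  refine ⟨?_, by linarith⟩
  -- For p = 2 the main term is itself O(α 2^(α-1)), so nonnegativity of the count suffices. The
  -- main labels include family 4 and are valid only for odd p.
  by_cases hp2 : p = 2
  · subst hp2
    have h1 : ((2 : ℕ) : ℝ) ^ α = 2 * ((2 : ℕ) : ℝ) ^ (α - 1) := by
      rw [Nat.cast_two, ← pow_succ', Nat.sub_add_cancel hα]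
    have h2 : (0 : ℝ) ≤ numClasses (2 ^ α) := Nat.cast_nonneg _
    have h3 : (0 : ℝ) ≤ ((2 : ℕ) : ℝ) ^ (α - 1) := by positivity
    rw [h1]
    nlinarith
  · have hlow : (mainLabels p α).card ≤ numClasses (p ^ α) := by
      rw [hN, ← Set.ncard_coe_finset]
      exact Set.ncard_le_ncard (fun l hl => mainLabels_valid hp2 hα hl) hfin
    rify at hlow
    linarith

end Families

end GPM

end

theorem theorem4 :
    (∀ (p α : ℕ) [Fact p.Prime], 1 ≤ α →
      (∀ l : GPM.Label, l.Valid p α → GPM.IsTriple (p ^ α) (l.rep p (p ^ α))) ∧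
      (∀ T : Set (Matrix (ZMod (p ^ α)) (ZMod (p ^ α)) ℂ), GPM.IsTriple (p ^ α) T →
        ∃ l : GPM.Label, l.Valid p α ∧ GPM.UEquiv T (l.rep p (p ^ α))) ∧
      (∀ l l' : GPM.Label, l.Valid p α → l'.Valid p α →
        GPM.UEquiv (l.rep p (p ^ α)) (l'.rep p (p ^ α)) → l = l')) ∧
    (∃ C : ℝ, ∀ (p α : ℕ) [Fact p.Prime], 1 ≤ α →
      |(GPM.numClasses (p ^ α) : ℝ) - ((α : ℝ) + 3) / 6 * (p : ℝ) ^ α| ≤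
        C * ((α : ℝ) * (p : ℝ) ^ (α - 1))) := by
  refine ⟨fun p α _ hα => ⟨fun l hl => GPM.Label.isTriple_rep hl,
    fun T hT => GPM.exists_label_uEquiv hT, fun l l' hl hl' h => GPM.Label.eq_of_uEquiv hl hl' h⟩,
    40, fun p α _ hα => GPM.abs_numClasses_sub_le hα⟩
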